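/- Let $X$ be a compact Hausdorff space with a positive Radon measure $\nu$ on its Borel $\sigma$-algebra, and let $Z=X\setminus N$ with $\nu(N)=0$, equipped with the subspace topology, its Borel $\sigma$-algebra and the restriction of $\nu$. Let $C(Z)$ be the Banach space of bounded continuous (real- or complex-valued) functions on $Z$ with the supremum norm. Let $k\colon Z\times Z\to[0,\infty)$ be a measurable kernel (if $k$ is given only on a measurable subset of $Z\times Z$, extend it by $0$) such that $$\int_Z\int_Z k(x,y)\,\nu(dy)\,\nu(dx)<\infty ,\qquad 0<\deg(z):=\int_Z k(z,y)\,\nu(dy)<\infty\quad\text{for all } z\in Z,$$ and assume that the Laplacian integral operator $$\mathscr{L}\psi(z)=\int_Z k(z,y)\,\bigl(\psi(y)-\psi(z)\bigr)\,\nu(dy)$$ maps $C(Z)$ to itself and is bounded. Then there are probability measures $p_t(z,\cdot)$, $t\ge 0$, $z\in Z$, on the Borel $\sigma$-algebra of $Z$, forming a transition function (that is, $z\mapsto p_t(z,B)$ is measurable for every Borel set $B$, $p_0(z,\cdot)=\delta_z$, and $p_{s+t}(z,B)=\int_Z p_t(y,B)\,p_s(z,dy)$), such that the following hold. 1. For every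 $h_0\in C(Z)$ the Cauchy problem $$\frac{\partial}{\partial t}h(t,\cdot)=\mathscr{L}h(t,\cdot)\quad(t>0),\qquad h(0,\cdot)=h_0,$$ has exactly one solution $h\colon[0,\infty)\to C(Z)$ that is continuous on $[0,\infty)$ and continuously differentiable on $(0,\infty)$ with respect to the supremum norm, and it is given by $$h(t,z)=\int_Z h_0(y)\,p_t(z,dy)\qquad(t\ge0,\ z\in Z).$$ 2. $p_t(z,\cdot)$ is the transition function of a strong Markov process with state space $Z$, all of whose paths are right continuous and have no discontinuities other than jumps. That is, there are a measurable space $\Omega$, measurable maps $Y_t\colon\Omega\to Z$ $(t\ge0)$ and probability measures $P_z$ on $\Omega$, depending measurably on $z\in Z$, such that: for every $\omega\in\Omega$ the path $t\mapsto Y_t(\omega)$ is right continuous and has a left limit in $Z$ at every $t>0$; $P_z(Y_0=z)=1$; with $\mathcal{F}_t=\sigma(Y_s:s\le t)$, $P_z(Y_{s+t}\in B\mid\mathcal{F}_s)=p_t(Y_s,B)$ $P_z$-almost surely, for all $s,t\ge0$ and all Borel sets $B$; and for every stopping time $\tau\colon\Omega\to[0,\infty]$ of the filtration $(\mathcal{F}_{t+})_{t\ge0}$,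 $Y_\tau$ is $\mathcal{F}_{\tau+}$-measurable on $\{\tau<\infty\}$ and there $P_z(Y_{\tau+t}\in B\mid\mathcal{F}_{\tau+})=p_t(Y_\tau,B)$ $P_z$-almost surely, for all $t\ge 0$ and all Borel sets $B$. -/

import Mathlib

open MeasureTheory ProbabilityTheory Set Filter
open scoped NNReal ENNReal Topology BoundedContinuousFunction

universe u

namespace HeatMarkov

/-- The degree function `deg z = ∫ k(z, y) ν(dy)`, as a number in `[0, ∞]`. -/
noncomputable def degree {Z : Type*} [MeasurableSpace Z] (ν : Measure Z) (k : Z → Z → ℝ≥0)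
    (z : Z) : ℝ≥0∞ :=
  ∫⁻ y, (k z y : ℝ≥0∞) ∂ν

/-- The Laplacian integral operator with kernel `k`:
`(ℒ ψ)(z) = ∫ k(z, y) (ψ(y) - ψ(z)) ν(dy)`. -/
noncomputable def laplacian {Z : Type*} [MeasurableSpace Z] {𝕜 : Type*} [RCLike 𝕜]
    (ν : Measure Z) (k : Z → Z → ℝ≥0) (ψ : Z → 𝕜) (z : Z) : 𝕜 :=
  ∫ y, ((k z y : ℝ≥0) : ℝ) • (ψ y - ψ z) ∂ν

/-- `h` solves the Cauchy problem `∂h/∂t = L h`, `h(0) = h₀` in the Banach space `E`: it is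
continuous on `[0, ∞)`, of class `C¹` on `(0, ∞)`, satisfies the equation for all `t > 0`, and has
initial value `h₀`. The values `h t` for `t < 0` play no role. -/
structure IsCauchySolution {E : Type*} [NormedAddCommGroup E] [NormedSpace ℝ E]
    (L : E → E) (h₀ : E) (h : ℝ → E) : Prop where
  continuousOn : ContinuousOn h (Ici 0)
  contDiffOn : ContDiffOn ℝ 1 h (Ioi 0)
  hasDerivAt : ∀ t : ℝ, 0 < t → HasDerivAt h (L (h t)) t
  initial : h 0 = h₀

/-- A (normal, conservative) time-homogeneous transition function on `Z`: for each `t ≥ 0` a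
family `p t z` of probability measures, measurable in `z`, with `p 0 z` the unit mass at `z` and
with the Chapman-Kolmogorov equation `p (s + t) z B = ∫ p t y B  p s z (dy)`. -/
structure IsTransitionFunction {Z : Type*} [MeasurableSpace Z] (p : ℝ≥0 → Kernel Z Z) :
    Prop where
  isMarkovKernel : ∀ t, IsMarkovKernel (p t)
  zero : ∀ z, p 0 z = Measure.dirac z
  chapman_kolmogorov : ∀ (s t : ℝ≥0) (z : Z) (B : Set Z), MeasurableSet B →
    p (s + t) z B = ∫⁻ y, p t y B ∂(p s z)

/-- The filtration `ℱ_t = σ(X_s : s ≤ t)` generated by the process `X`. -/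
def pathFiltration {Ω Z : Type*} [mΩ : MeasurableSpace Ω] [mZ : MeasurableSpace Z]
    (X : ℝ≥0 → Ω → Z) (hX : ∀ t, Measurable (X t)) : Filtration ℝ≥0 mΩ where
  seq t := ⨆ s ≤ t, MeasurableSpace.comap (X s) mZ
  mono' _ _ hst := biSup_mono fun _ hr => hr.trans hst
  le' _ := iSup₂_le fun s _ => (hX s).comap_le

/-- `(Ω, X, (P z)_z)` is a Markov process with transition function `p`: `P z` is a probability
measure, measurable in `z`, under which `X` starts at `z`, and the conditional probability
under `P z` of `X_{s+t} ∈ B` given `ℱ_s = σ(X_r : r ≤ s)` is `p t (X_s) B`. -/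
structure IsMarkovProcess {Ω Z : Type*} [MeasurableSpace Ω] [MeasurableSpace Z]
    (p : ℝ≥0 → Kernel Z Z) (P : Kernel Z Ω) (X : ℝ≥0 → Ω → Z) : Prop where
  measurable : ∀ t, Measurable (X t)
  isMarkovKernel : IsMarkovKernel P
  start : ∀ z, ∀ᵐ ω ∂(P z), X 0 ω = z
  markov : ∀ (z : Z) (s t : ℝ≥0) (A : Set Ω), MeasurableSet[pathFiltration X measurable s] A →
    ∀ B : Set Z, MeasurableSet B →
      P z (A ∩ {ω | X (s + t) ω ∈ B}) = ∫⁻ ω in A, p t (X s ω) B ∂(P z)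

/-- A Markov process with the strong Markov property: for every stopping time `τ ≤ ∞` of the
right-continuous filtration `ℱ_{t+}` (that is, `{τ < t} ∈ ℱ_t` for all `t`), the variable `X_τ` is
`ℱ_{τ+}`-measurable on `{τ < ∞}`, and on `{τ < ∞}` the conditional probability under `P z` of
`X_{τ+t} ∈ B` given `ℱ_{τ+}` is `p t (X_τ) B`. -/
structure IsStrongMarkovProcess {Ω Z : Type*} [MeasurableSpace Ω] [MeasurableSpace Z]
    (p : ℝ≥0 → Kernel Z Z) (P : Kernel Z Ω) (X : ℝ≥0 → Ω → Z) : Prop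
    extends IsMarkovProcess p P X where
  measurable_at : ∀ (τ : Ω → WithTop ℝ≥0)
    (hτ : IsStoppingTime (pathFiltration X measurable).rightCont τ) (B : Set Z),
    MeasurableSet B → MeasurableSet[hτ.measurableSpace] {ω | τ ω ≠ ⊤ ∧ X (τ ω).untopA ω ∈ B}
  strong_markov : ∀ (τ : Ω → WithTop ℝ≥0)
    (hτ : IsStoppingTime (pathFiltration X measurable).rightCont τ)
    (z : Z) (t : ℝ≥0) (A : Set Ω), MeasurableSet[hτ.measurableSpace] A →
    ∀ B : Set Z, MeasurableSet B →
      P z (A ∩ {ω | τ ω ≠ ⊤ ∧ X ((τ ω).untopA + t) ω ∈ B}) =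
        ∫⁻ ω in A ∩ {ω | τ ω ≠ ⊤}, p t (X (τ ω).untopA ω) B ∂(P z)

/-- The path `x` is right continuous and has no discontinuities other than jumps: at every time
it is continuous from the right and has a limit from the left. -/
def IsCadlagPath {Z : Type*} [TopologicalSpace Z] (x : ℝ≥0 → Z) : Prop :=
  ∀ t : ℝ≥0, ContinuousWithinAt x (Ici t) t ∧ ∃ l : Z, Tendsto x (𝓝[<] t) (𝓝 l)

end HeatMarkov

/-! The proof is by uniformization. Boundedness of `L` bounds the mass that `k z` puts off the point
`z` by `‖L‖`, uniformly in `z`: applied to a continuous function vanishing at `z` and equal to 1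
outside a small neighbourhood of `z`, `L` recovers almost all of that mass (`degree_offDiag_le`).
Mass at `z` itself does not enter the Laplacian and is dropped. With `c = ‖L‖ + 1`, the off-diagonal
kernel divided by `c` and completed by an atom at `z` is a Markov kernel (`lazyKernel`), and
averaging against it is an operator `A` with `L = c (A - 1)`.

Hence `exp (t L)` is the average of the powers `A ^ n` with Poisson weights of mean `c t`
(`hasSum_exp_smul_sub_one`). This is integration against the law at time `t` of a Markov chain run
by an independent Poisson clock of rate `c` (`exp_apply_eq_integral_jumpTransition`). As `L` is
bounded, the exponential is the only solution of the Cauchy problem (`IsCauchySolution.eq_exp`).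

The process is this chain with its clock. It is Markov because the chain is and because the clock
has independent Poisson increments (`jumpProcess_markov`). The clock lives on sequences of waiting
times with divergent sum, so every path is a step function with finitely many ticks in bounded time.
This gives left limits in `Z` without compactness, and the strong Markov property follows by
discretising stopping times, without a Feller argument (`isStrongMarkovProcess_of_isMarkovProcess`).
-/

namespace HeatMarkov

/-! ### Strong Markov property for right-constant paths -/

section StrongMarkov

variable {Ω : Type*} {mΩ : MeasurableSpace Ω}

theorem rightCont_le_of_lt (f : Filtration ℝ≥0 mΩ) {s t : ℝ≥0} (h : s < t) :
    f.rightCont s ≤ f t := by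
  rw [Filtration.rightCont_eq]
  exact iInf₂_le t h

/-- An event of `ℱ_{τ+}` intersected with `{τ < s}` belongs to `ℱ_s`. -/
theorem measurableSet_inter_lt {f : Filtration ℝ≥0 mΩ} {τ : Ω → WithTop ℝ≥0}
    (hτ : IsStoppingTime f.rightCont τ) {A : Set Ω} (hA : MeasurableSet[hτ.measurableSpace] A)
    (s : ℝ≥0) : MeasurableSet[f s] (A ∩ {ω | τ ω < s}) := by
  obtain ⟨D, hDc, hD⟩ := TopologicalSpace.exists_countable_dense ℝ≥0
  have : A ∩ {ω | τ ω < s} = ⋃ q ∈ D ∩ Iio s, A ∩ {ω | τ ω ≤ q} := by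
    ext ω
    simp only [mem_inter_iff, mem_ofPred_eq, mem_iUnion, mem_Iio, exists_prop]
    constructor
    · rintro ⟨hω, h⟩
      obtain ⟨r, hr⟩ := WithTop.ne_top_iff_exists.1 h.ne_top
      rw [← hr, WithTop.coe_lt_coe] at h
      obtain ⟨q, hq, h1, h2⟩ := hD.exists_between h
      exact ⟨q, ⟨hq, h2⟩, hω, by rw [← hr]; exact WithTop.coe_le_coe.2 h1.le⟩
    · rintro ⟨q, ⟨-, hqs⟩, hω, hq⟩
      exact ⟨hω, hq.trans_lt (WithTop.coe_lt_coe.2 hqs)⟩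
  rw [this]
  exact MeasurableSet.biUnion (hDc.mono inter_subset_left) fun q hq =>
    rightCont_le_of_lt f hq.2 _ (hA.2 q)

/-- The grid point `(k + 1) / (n + 1)`. -/
noncomputable def gridPoint (n k : ℕ) : ℝ≥0 := (k + 1) / (n + 1)

/-- The event that the random time `τ` lies in `[k / (n + 1), (k + 1) / (n + 1))`. -/
def gridEvent (τ : Ω → WithTop ℝ≥0) (n k : ℕ) : Set Ω :=
  {ω | τ ω < gridPoint n k} \ {ω | τ ω < ((k / (n + 1) : ℝ≥0) : WithTop ℝ≥0)}

/-- The index of the grid interval of mesh `1 / (n + 1)` containing `r`. -/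
noncomputable def gridIndex (n : ℕ) (r : ℝ≥0) : ℕ := ⌊(n + 1) * r⌋₊

theorem untopA_coe (r : ℝ≥0) : (r : WithTop ℝ≥0).untopA = r := rfl

theorem mem_gridEvent_iff {τ : Ω → WithTop ℝ≥0} {n k : ℕ} {ω : Ω} :
    ω ∈ gridEvent τ n k ↔ τ ω ≠ ⊤ ∧ gridIndex n (τ ω).untopA = k := by
  by_cases h : τ ω = ⊤
  · simp only [gridEvent, Set.mem_sdiff, mem_ofPred_eq, h, not_top_lt, false_and, ne_eq,
      not_true_eq_false]
  obtain ⟨r, hr⟩ := WithTop.ne_top_iff_exists.1 h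
  have hn : (0 : ℝ≥0) < n + 1 := by positivity
  simp only [gridEvent, gridPoint, gridIndex, Set.mem_sdiff, mem_ofPred_eq, ← hr, WithTop.coe_lt_coe,
    WithTop.coe_ne_top, ne_eq, not_false_eq_true, true_and, untopA_coe, not_lt]
  rw [Nat.floor_eq_iff (by positivity), lt_div_iff₀ hn, div_le_iff₀ hn, mul_comm r, and_comm]

theorem lt_gridPoint (n : ℕ) (r : ℝ≥0) : r < gridPoint n (gridIndex n r) := by
  have hn : (0 : ℝ≥0) < n + 1 := by positivity
  rw [gridPoint, lt_div_iff₀ hn, mul_comm]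
  exact Nat.lt_floor_add_one _

theorem gridPoint_le (n : ℕ) (r : ℝ≥0) : gridPoint n (gridIndex n r) ≤ r + 1 / (n + 1) := by
  have hn : (0 : ℝ≥0) < n + 1 := by positivity
  rw [gridPoint, div_le_iff₀ hn, add_mul, one_div, inv_mul_cancel₀ hn.ne', mul_comm r]
  gcongr
  exact Nat.floor_le (by positivity)

/-- The approximation is strictly from the right, which is where right-constancy of the paths
applies. -/
theorem tendsto_gridPoint (r : ℝ≥0) :
    Tendsto (fun n => gridPoint n (gridIndex n r)) atTop (𝓝[>] r) := by
  refine tendsto_nhdsWithin_iff.2 ⟨?_, Eventually.of_forall fun n => lt_gridPoint n r⟩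
  refine tendsto_of_tendsto_of_tendsto_of_le_of_le tendsto_const_nhds ?_
    (fun n => (lt_gridPoint n r).le) fun n => gridPoint_le n r
  have : Tendsto (fun n : ℕ => (1 : ℝ≥0) / (n + 1)) atTop (𝓝 0) := by
    rw [← NNReal.tendsto_coe]
    simpa using tendsto_one_div_add_atTop_nhds_zero_nat (𝕜 := ℝ)
  simpa using tendsto_const_nhds.add this

/-- The grid intervals are open on the right, so only events `{τ < s}` occur. These lie in `f s`
itself, whereas `{τ ≤ s}` is only known to lie in `f.rightCont s`. -/
theorem measurableSet_inter_gridEvent {f : Filtration ℝ≥0 mΩ} {τ : Ω → WithTop ℝ≥0}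
    (hτ : IsStoppingTime f.rightCont τ) {A : Set Ω} (hA : MeasurableSet[hτ.measurableSpace] A)
    (n k : ℕ) : MeasurableSet[f (gridPoint n k)] (A ∩ gridEvent τ n k) := by
  rw [gridEvent, ← inter_sdiff_assoc]
  refine (measurableSet_inter_lt hτ hA _).diff ?_
  have := measurableSet_inter_lt hτ MeasurableSet.univ (k / (n + 1))
  rw [univ_inter] at this
  refine f.mono ?_ _ this
  rw [gridPoint]
  gcongr
  exact le_self_add

theorem iUnion_gridEvent (τ : Ω → WithTop ℝ≥0) (n : ℕ) :
    ⋃ k, gridEvent τ n k = {ω | τ ω ≠ ⊤} := by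
  ext ω
  simp [mem_gridEvent_iff]

theorem pairwise_disjoint_gridEvent (τ : Ω → WithTop ℝ≥0) (n : ℕ) :
    Pairwise (Function.onFun Disjoint (gridEvent τ n)) := by
  intro i j hij
  rw [Function.onFun, Set.disjoint_left]
  intro ω h1 h2
  exact hij ((mem_gridEvent_iff.1 h1).2.symm.trans (mem_gridEvent_iff.1 h2).2)

variable {Z : Type*} [MeasurableSpace Z] {p : ℝ≥0 → Kernel Z Z} {P : Kernel Z Ω}
  {X : ℝ≥0 → Ω → Z}

theorem measurable_pathFiltration (hX : ∀ t, Measurable (X t)) {s t : ℝ≥0} (h : s ≤ t) :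
    Measurable[pathFiltration X hX t] (X s) := by
  rw [measurable_iff_comap_le]
  exact le_biSup (fun r => MeasurableSpace.comap (X r) _) h

omit [MeasurableSpace Z] in
-- The discretised states become equal to the limit state, rather than merely close to it. Hence no
-- continuity of `p t` in the starting point is needed later.
theorem eventually_gridPoint (hstep : ∀ ω t, ∀ᶠ u in 𝓝[>] t, X u ω = X t ω) (ω : Ω)
    (r t : ℝ≥0) : ∀ᶠ n in atTop, X (gridPoint n (gridIndex n r) + t) ω = X (r + t) ω := by
  have h : Tendsto (fun u => u + t) (𝓝[>] r) (𝓝[>] (r + t)) := by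
    refine tendsto_nhdsWithin_iff.2 ⟨?_, ?_⟩
    · exact ((continuous_id.add continuous_const).tendsto r).mono_left nhdsWithin_le_nhds
    · filter_upwards [self_mem_nhdsWithin] with u hu
      exact add_lt_add_left (show r < u from hu) t
  exact (h.comp (tendsto_gridPoint r)).eventually (hstep ω (r + t))

theorem measurableSet_stopped (hX : ∀ t, Measurable (X t))
    (hstep : ∀ ω t, ∀ᶠ u in 𝓝[>] t, X u ω = X t ω) {τ : Ω → WithTop ℝ≥0}
    (hτ : IsStoppingTime (pathFiltration X hX).rightCont τ) {B : Set Z} (hB : MeasurableSet B) :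
    MeasurableSet[hτ.measurableSpace] {ω | τ ω ≠ ⊤ ∧ X (τ ω).untopA ω ∈ B} := by
  set f := pathFiltration X hX
  have key : ∀ i, MeasurableSet[f.rightCont i]
      ({ω | τ ω ≠ ⊤ ∧ X (τ ω).untopA ω ∈ B} ∩ {ω | τ ω ≤ i}) := by
    intro i
    rw [Filtration.rightCont_eq]
    simp only [MeasurableSpace.measurableSet_iInf]
    intro s his
    -- From mesh `1 / (n₀ + 1)` on, the grid point following a value `τ ≤ i` is at most `s`, so the
    -- discretised state is known at time `s`.
    obtain ⟨n₀, hn₀⟩ : ∃ n₀ : ℕ, (i : ℝ≥0) + 1 / (n₀ + 1) ≤ s := by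
      obtain ⟨n, hn⟩ := exists_nat_one_div_lt (tsub_pos_of_lt his)
      exact ⟨n, by rw [add_comm]; exact (lt_tsub_iff_right.1 hn).le⟩
    let G : ℕ → Set Ω := fun n =>
      ⋃ k, gridEvent τ n k ∩ {ω | X (gridPoint n k) ω ∈ B} ∩ {ω | τ ω ≤ i}
    have hG : ∀ n ≥ n₀, MeasurableSet[f s] (G n) := by
      intro n hn
      refine MeasurableSet.iUnion fun k => ?_
      by_cases hk : gridPoint n k ≤ s
      · refine MeasurableSet.inter (MeasurableSet.inter ?_ ?_) ?_
        · have := measurableSet_inter_gridEvent hτ MeasurableSet.univ n k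
          rw [univ_inter] at this
          exact f.mono hk _ this
        · exact measurable_pathFiltration hX hk hB
        · exact rightCont_le_of_lt f his _ (hτ i)
      · convert @MeasurableSet.empty _ (f s)
        ext ω
        simp only [mem_inter_iff, mem_ofPred_eq, mem_empty_iff_false, iff_false, mem_gridEvent_iff]
        rintro ⟨⟨⟨hω, rfl⟩, -⟩, hi⟩
        obtain ⟨r, hr⟩ := WithTop.ne_top_iff_exists.1 hω
        apply hk
        rw [← hr, WithTop.coe_le_coe] at hi
        rw [← hr, untopA_coe]
        refine (gridPoint_le n r).trans (le_trans ?_ hn₀)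
        gcongr
    -- The event is the lower limit of the discretised events, since the discretised state is
    -- eventually constant in `n`. Starting at `max n₀ m` keeps every term in `f s`.
    have : {ω | τ ω ≠ ⊤ ∧ X (τ ω).untopA ω ∈ B} ∩ {ω | τ ω ≤ i} =
        ⋃ m, ⋂ n, G (max n₀ m + n) := by
      ext ω
      simp only [mem_inter_iff, mem_ofPred_eq, mem_iUnion, mem_iInter, G, mem_gridEvent_iff]
      have ev := eventually_gridPoint hstep ω (τ ω).untopA 0
      simp only [add_zero] at ev
      obtain ⟨N, hN⟩ := eventually_atTop.1 ev
      constructor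
      · rintro ⟨⟨h1, h2⟩, h3⟩
        refine ⟨N, fun n => ⟨_, ⟨⟨h1, rfl⟩, ?_⟩, h3⟩⟩
        rw [hN _ (by omega)]
        exact h2
      · rintro ⟨m, hm⟩
        obtain ⟨k, ⟨⟨h1, h2⟩, h3⟩, h4⟩ := hm N
        refine ⟨⟨h1, ?_⟩, h4⟩
        rw [← h2, hN _ (by omega)] at h3
        exact h3
    rw [this]
    exact MeasurableSet.iUnion fun m => MeasurableSet.iInter fun n => hG _ (by omega)
  -- Besides `key`, the event must lie in the supremum of the filtration; it is exhausted by the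
  -- events with `τ ≤ n`.
  refine ⟨?_, key⟩
  have : {ω | τ ω ≠ ⊤ ∧ X (τ ω).untopA ω ∈ B} =
      ⋃ n : ℕ, {ω | τ ω ≠ ⊤ ∧ X (τ ω).untopA ω ∈ B} ∩ {ω | τ ω ≤ ((n : ℝ≥0) : WithTop ℝ≥0)} := by
    ext ω
    simp only [mem_ofPred_eq, mem_iUnion, mem_inter_iff, exists_and_left, iff_self_and]
    rintro ⟨h, -⟩
    obtain ⟨r, hr⟩ := WithTop.ne_top_iff_exists.1 h
    obtain ⟨n, hn⟩ := exists_nat_ge r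
    exact ⟨n, by rw [← hr]; exact WithTop.coe_le_coe.2 hn⟩
  rw [this]
  exact MeasurableSet.iUnion fun n => le_iSup f.rightCont (n : ℝ≥0) _ (key n)

/-- A Markov process whose paths are locally constant on the right is a strong Markov process. -/
theorem isStrongMarkovProcess_of_isMarkovProcess [hp : ∀ t, IsMarkovKernel (p t)]
    (h : IsMarkovProcess p P X) (hstep : ∀ ω t, ∀ᶠ u in 𝓝[>] t, X u ω = X t ω) :
    IsStrongMarkovProcess p P X where
  toIsMarkovProcess := h
  measurable_at τ hτ B hB := measurableSet_stopped h.measurable hstep hτ hB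
  strong_markov τ hτ z t A hA B hB := by
    have := h.isMarkovKernel
    set f := pathFiltration X h.measurable
    have hAm : MeasurableSet A := hτ.measurableSpace_le _ hA
    have hE : ∀ n k, MeasurableSet (gridEvent τ n k) := fun n k => by
      have := f.le _ _ (measurableSet_inter_gridEvent hτ MeasurableSet.univ n k)
      rwa [univ_inter] at this
    have hT : MeasurableSet {ω | τ ω ≠ ⊤} := by
      rw [← iUnion_gridEvent τ 0]
      exact MeasurableSet.iUnion fun k => hE 0 k
    let T : ℕ → Ω → ℝ≥0 := fun n ω => gridPoint n (gridIndex n (τ ω).untopA)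
    have hset : ∀ n, A ∩ {ω | τ ω ≠ ⊤ ∧ X (T n ω + t) ω ∈ B} =
        ⋃ k, A ∩ gridEvent τ n k ∩ {ω | X (gridPoint n k + t) ω ∈ B} := by
      intro n
      ext ω
      simp only [T, mem_inter_iff, mem_ofPred_eq, mem_iUnion, mem_gridEvent_iff]
      constructor
      · rintro ⟨h1, h2, h3⟩
        exact ⟨_, ⟨h1, h2, rfl⟩, h3⟩
      · rintro ⟨k, ⟨h1, h2, rfl⟩, h3⟩
        exact ⟨h1, h2, h3⟩
    have hsetm : ∀ n, MeasurableSet (A ∩ {ω | τ ω ≠ ⊤ ∧ X (T n ω + t) ω ∈ B}) := fun n => by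
      rw [hset]
      exact MeasurableSet.iUnion fun k => (hAm.inter (hE n k)).inter (h.measurable _ hB)
    have hpm : ∀ u, Measurable fun ω => p t (X u ω) B := fun u =>
      ((p t).measurable_coe hB).comp (h.measurable u)
    have hfm : ∀ n, Measurable
        ((A ∩ {ω | τ ω ≠ ⊤}).indicator fun ω => p t (X (T n ω) ω) B) := by
      intro n
      have : ((A ∩ {ω | τ ω ≠ ⊤}).indicator fun ω => p t (X (T n ω) ω) B) = fun ω =>
          ∑' k, (A ∩ gridEvent τ n k).indicator (fun ω => p t (X (gridPoint n k) ω) B) ω := by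
        ext ω
        by_cases hω : ω ∈ A ∩ {ω | τ ω ≠ ⊤}
        · rw [indicator_of_mem hω, tsum_eq_single (gridIndex n (τ ω).untopA), indicator_of_mem]
          · exact ⟨hω.1, mem_gridEvent_iff.2 ⟨hω.2, rfl⟩⟩
          · intro k hk
            rw [indicator_of_notMem]
            rintro ⟨-, h2⟩
            exact hk (mem_gridEvent_iff.1 h2).2.symm
        · rw [indicator_of_notMem hω]
          symm
          rw [ENNReal.tsum_eq_zero]
          intro k
          rw [indicator_of_notMem]
          rintro ⟨h1, h2⟩
          exact hω ⟨h1, (mem_gridEvent_iff.1 h2).1⟩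
      rw [this]
      exact Measurable.tsum fun k => (hpm _).indicator (hAm.inter (hE n k))
    -- On each grid event `T n` is a fixed time, so the ordinary Markov property applies there;
    -- summing over the grid gives the strong one for `T n`.
    have heq : ∀ n, P z (A ∩ {ω | τ ω ≠ ⊤ ∧ X (T n ω + t) ω ∈ B}) =
        ∫⁻ ω in A ∩ {ω | τ ω ≠ ⊤}, p t (X (T n ω) ω) B ∂(P z) := by
      intro n
      have hd : Pairwise (Function.onFun Disjoint fun k => A ∩ gridEvent τ n k) :=
        fun i j hij => (pairwise_disjoint_gridEvent τ n hij).mono inter_subset_right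
          inter_subset_right
      have hX : ∀ k, MeasurableSet {ω | X (gridPoint n k + t) ω ∈ B} := fun k =>
        h.measurable _ hB
      rw [hset, measure_iUnion (fun i j hij => (hd hij).mono inter_subset_left inter_subset_left)
        fun k => (hAm.inter (hE n k)).inter (hX k), ← iUnion_gridEvent τ n,
        inter_iUnion, lintegral_iUnion (fun k => hAm.inter (hE n k)) hd]
      congr 1
      ext k
      rw [h.markov z _ t _ (measurableSet_inter_gridEvent hτ hA n k) B hB]
      refine setLIntegral_congr_fun (hAm.inter (hE n k)) fun ω hω => ?_
      simp only [T, (mem_gridEvent_iff.1 hω.2).2]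
    have hl : Tendsto (fun n => P z (A ∩ {ω | τ ω ≠ ⊤ ∧ X (T n ω + t) ω ∈ B})) atTop
        (𝓝 (P z (A ∩ {ω | τ ω ≠ ⊤ ∧ X ((τ ω).untopA + t) ω ∈ B}))) := by
      refine tendsto_measure_of_tendsto_indicator_of_isFiniteMeasure atTop _ hsetm ?_
      intro ω
      filter_upwards [eventually_gridPoint hstep ω (τ ω).untopA t] with n hn
      simp only [T, mem_inter_iff, mem_ofPred_eq, hn]
    have hr : Tendsto (fun n => ∫⁻ ω in A ∩ {ω | τ ω ≠ ⊤}, p t (X (T n ω) ω) B ∂(P z)) atTop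
        (𝓝 (∫⁻ ω in A ∩ {ω | τ ω ≠ ⊤}, p t (X (τ ω).untopA ω) B ∂(P z))) := by
      simp_rw [← lintegral_indicator (hAm.inter hT)]
      refine tendsto_lintegral_of_dominated_convergence (fun _ => 1) hfm ?_ ?_ ?_
      · intro n
        refine ae_of_all _ fun ω => ?_
        refine indicator_le' (fun _ _ => prob_le_one) (fun _ _ => zero_le) ω
      · simp
      · refine ae_of_all _ fun ω => tendsto_const_nhds.congr' ?_
        filter_upwards [eventually_gridPoint hstep ω (τ ω).untopA 0] with n hn
        simp only [add_zero] at hn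
        simp only [T, indicator, hn]
    exact tendsto_nhds_unique hl (by simpa only [heq] using hr)

end StrongMarkov

end HeatMarkov

namespace HeatMarkov

/-! ### The discrete-time Markov chain -/

section Chain

variable {Z : Type*} [MeasurableSpace Z]

/-- The `n`-step transition kernel of the Markov chain with transition kernel `κ`. -/
noncomputable def kernelPow (κ : Kernel Z Z) : ℕ → Kernel Z Z
  | 0 => Kernel.id
  | n + 1 => kernelPow κ n ∘ₖ κ

instance (κ : Kernel Z Z) [IsMarkovKernel κ] (n : ℕ) : IsMarkovKernel (kernelPow κ n) := by
  induction n with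
  | zero => rw [kernelPow]; infer_instance
  | succ n ih => rw [kernelPow]; infer_instance

/-- The law of the Markov chain with transition kernel `κ`, as a kernel from the initial state to
the space of sequences. -/
noncomputable def chainKernel (κ : Kernel Z Z) [IsMarkovKernel κ] : Kernel Z (ℕ → Z) :=
  (Kernel.traj (X := fun _ => Z) (fun n => κ.comap (fun x => x ⟨n, Finset.mem_Iic.2 le_rfl⟩)
    (measurable_pi_apply _)) 0).comap (fun z _ => z) (measurable_pi_lambda _ fun _ => measurable_id)

instance (κ : Kernel Z Z) [IsMarkovKernel κ] : IsMarkovKernel (chainKernel κ) := by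
  rw [chainKernel]; infer_instance

variable (κ : Kernel Z Z) [IsMarkovKernel κ]

theorem chainKernel_zero (z : Z) {B : Set Z} (hB : MeasurableSet B) :
    chainKernel κ z {x | x 0 ∈ B} = Measure.dirac z B := by
  have h := Kernel.traj_map_frestrictLe_apply (X := fun _ => Z)
    (κ := fun n => κ.comap (fun x => x ⟨n, Finset.mem_Iic.2 le_rfl⟩) (measurable_pi_apply _))
    0 0 (fun _ => z)
  rw [Kernel.partialTraj_self, Kernel.id_apply] at h
  have hm : Measurable fun x : (Finset.Iic 0 → Z) => x ⟨0, Finset.mem_Iic.2 le_rfl⟩ :=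
    measurable_pi_apply _
  have := congrArg (fun m => m.map fun x => x ⟨0, Finset.mem_Iic.2 le_rfl⟩) h
  rw [Measure.map_map hm (Preorder.measurable_frestrictLe 0), Measure.map_dirac' hm] at this
  have h2 := congrArg (fun m => m B) this
  rw [Measure.map_apply (hm.comp (Preorder.measurable_frestrictLe 0)) hB] at h2
  exact h2

/-- The one-step Markov property of the chain. -/
theorem lintegral_chainKernel_succ (z : Z) (n : ℕ) {A : Set (ℕ → Z)}
    (hA : MeasurableSet[⨆ i ≤ n, MeasurableSpace.comap (fun x : ℕ → Z => x i) inferInstance] A)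
    {g : Z → ℝ≥0∞} (hg : Measurable g) :
    ∫⁻ x in A, g (x (n + 1)) ∂(chainKernel κ z) =
      ∫⁻ x in A, ∫⁻ y, g y ∂(κ (x n)) ∂(chainKernel κ z) := by
  -- An event of the first `n` steps is a cylinder over the restriction to `Iic n`.
  obtain ⟨S, hS, rfl⟩ : ∃ S : Set (Finset.Iic n → Z), MeasurableSet S ∧
      Preorder.frestrictLe n ⁻¹' S = A := by
    have : (⨆ i ≤ n, MeasurableSpace.comap (fun x : ℕ → Z => x i) inferInstance) ≤
        MeasurableSpace.comap (Preorder.frestrictLe (π := fun _ => Z) n) MeasurableSpace.pi := by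
      refine iSup₂_le fun i hi => ?_
      rw [← measurable_iff_comap_le]
      exact (measurable_pi_apply (⟨i, Finset.mem_Iic.2 hi⟩ : Finset.Iic n)).comp
        (comap_measurable (Preorder.frestrictLe (π := fun _ => Z) n))
    exact this _ hA
  let η : (n : ℕ) → Kernel (Finset.Iic n → Z) Z := fun n =>
    κ.comap (fun x => x ⟨n, Finset.mem_Iic.2 le_rfl⟩) (measurable_pi_apply _)
  have h := Kernel.partialTraj_compProd_eq_map_traj (X := fun _ => Z) (κ := η) (Nat.zero_le n)
    (x₀ := fun _ => z)
  have hQ : chainKernel κ z = Kernel.traj (X := fun _ => Z) η 0 (fun _ => z) := rfl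
  have hpm : Measurable fun x : ℕ → Z => (Preorder.frestrictLe n x, x (n + 1)) :=
    (Preorder.measurable_frestrictLe n).prodMk (measurable_pi_apply _)
  have hr : Measurable (Preorder.frestrictLe (π := fun _ => Z) n) :=
    Preorder.measurable_frestrictLe n
  have hg2 : Measurable fun q : (Finset.Iic n → Z) × Z => g q.2 := hg.comp measurable_snd
  have h1 : ∫⁻ x in Preorder.frestrictLe n ⁻¹' S, g (x (n + 1)) ∂(chainKernel κ z) =
      ∫⁻ q in S ×ˢ univ, g q.2 ∂((chainKernel κ z).map
        fun x : ℕ → Z => (Preorder.frestrictLe n x, x (n + 1))) := by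
    rw [setLIntegral_map (hS.prod MeasurableSet.univ) hg2 hpm]
    congr 2
    ext x
    simp
  rw [h1, hQ, ← h, Measure.setLIntegral_compProd hg2 hS MeasurableSet.univ,
    ← Kernel.traj_map_frestrictLe_apply]
  simp only [Measure.restrict_univ]
  rw [setLIntegral_map hS ?_ hr]
  · rfl
  · exact Measurable.lintegral_kernel hg

/-- The Markov property of the chain. -/
theorem chainKernel_markov (z : Z) (m : ℕ) : ∀ (n : ℕ) {A : Set (ℕ → Z)},
    MeasurableSet[⨆ i ≤ n, MeasurableSpace.comap (fun x : ℕ → Z => x i) inferInstance] A →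
    ∀ {B : Set Z}, MeasurableSet B →
    chainKernel κ z (A ∩ {x | x (n + m) ∈ B}) =
      ∫⁻ x in A, kernelPow κ m (x n) B ∂(chainKernel κ z) := by
  have hle : ∀ n, (⨆ i ≤ n, MeasurableSpace.comap (fun x : ℕ → Z => x i) inferInstance) ≤
      MeasurableSpace.pi := fun n =>
    iSup₂_le fun i _ => measurable_iff_comap_le.1 (measurable_pi_apply i)
  have hmono : ∀ n, (⨆ i ≤ n, MeasurableSpace.comap (fun x : ℕ → Z => x i) inferInstance) ≤
      ⨆ i ≤ n + 1, MeasurableSpace.comap (fun x : ℕ → Z => x i) inferInstance := fun n =>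
    biSup_mono fun i hi => le_trans hi n.le_succ
  induction m with
  | zero =>
    intro n A hA B hB
    have hB' : MeasurableSet {x : ℕ → Z | x n ∈ B} := measurable_pi_apply n hB
    simp only [kernelPow, Kernel.id_apply, Measure.dirac_apply' _ hB, add_zero]
    have : (fun x : ℕ → Z => B.indicator (1 : Z → ℝ≥0∞) (x n)) =
        {x : ℕ → Z | x n ∈ B}.indicator 1 := rfl
    rw [this, lintegral_indicator_one hB', Measure.restrict_apply hB', inter_comm]
  | succ m ih =>
    intro n A hA B hB
    -- The last `m` steps start from time `n + 1`, and the single step from `n` to `n + 1` is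
    -- integrated afterwards. This matches `kernelPow`, where the extra `κ` acts first.
    have h := ih (n + 1) (hmono n _ hA) hB
    rw [add_assoc, add_comm 1 m] at h
    rw [h, lintegral_chainKernel_succ κ z n hA ((kernelPow κ m).measurable_coe hB)]
    simp only [kernelPow, Kernel.comp_apply' _ _ _ hB]

end Chain

end HeatMarkov

namespace HeatMarkov

/-! ### Construction of the Poisson process -/

section PoissonProcess

/-- The standard exponential distribution, as a measure on `ℝ≥0`. -/
noncomputable def expNN : Measure ℝ≥0 := (expMeasure 1).map Real.toNNReal

instance : IsProbabilityMeasure expNN := by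
  have := isProbabilityMeasure_expMeasure one_pos
  exact Measure.isProbabilityMeasure_map measurable_real_toNNReal.aemeasurable

theorem expNN_Iic (u : ℝ≥0) : expNN (Iic u) = ENNReal.ofReal (1 - Real.exp (-u)) := by
  have h : Real.toNNReal ⁻¹' Iic u = Iic (u : ℝ) := by
    ext x
    exact Real.toNNReal_le_iff_le_coe
  rw [expNN, Measure.map_apply measurable_real_toNNReal measurableSet_Iic, h, expMeasure,
    gammaMeasure, withDensity_apply _ measurableSet_Iic]
  refine (lintegral_exponentialPDF_eq_antiDeriv one_pos (u : ℝ)).trans ?_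
  simp

theorem expNN_Ioi (u : ℝ≥0) : expNN (Ioi u) = ENNReal.ofReal (Real.exp (-u)) := by
  rw [← compl_Iic, prob_compl_eq_one_sub measurableSet_Iic, expNN_Iic, ← ENNReal.ofReal_one,
    ← ENNReal.ofReal_sub _ (by simp)]
  simp

theorem expNN_Iic_lt_one (u : ℝ≥0) : expNN (Iic u) < 1 := by
  rw [expNN_Iic, ENNReal.ofReal_lt_one]
  linarith [Real.exp_pos (-u)]

/-- The exponential density at `x` and the Poisson weight of mean `s + t - x` multiply to the
constant `exp (-(s + t))` times a power, which integrates to `t ^ (m + 1) / (m + 1)!`. This is the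
inductive step when conditioning on the first arrival. -/
theorem setLIntegral_expNN_poissonMeasure (s t : ℝ≥0) (m : ℕ) :
    ∫⁻ x in Ioc s (s + t), poissonMeasure (s + t - x) {m} ∂expNN =
      ENNReal.ofReal (Real.exp (-s)) * poissonMeasure t {m + 1} := by
  have h : Real.toNNReal ⁻¹' Ioc s (s + t) = Ioc (s : ℝ) (s + t) := by
    ext x
    rw [mem_preimage, mem_Ioc, mem_Ioc, Real.toNNReal_le_iff_le_coe, Real.lt_toNNReal_iff_coe_lt]
    rfl
  have hw : Measurable fun x : ℝ≥0 => poissonMeasure (s + t - x) {m} := by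
    simp only [poissonMeasure_singleton]
    fun_prop
  have hcongr : ∀ y ∈ Ioc (s : ℝ) (s + t),
      (gammaPDF 1 1 * fun y : ℝ => poissonMeasure (s + t - y.toNNReal) {m}) y =
      ENNReal.ofReal (Real.exp (-(s + t)) / m.factorial * (s + t - y) ^ m) := by
    intro y hy
    have hy0 : 0 ≤ y := s.2.trans hy.1.le
    have hyt : y.toNNReal ≤ s + t := Real.toNNReal_le_iff_le_coe.2 hy.2
    have : gammaPDF 1 1 y = ENNReal.ofReal (Real.exp (-y)) := by
      refine (exponentialPDF_of_nonneg (r := 1) hy0).trans ?_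
      simp
    rw [Pi.mul_apply, this, poissonMeasure_singleton, ← ENNReal.ofReal_mul (Real.exp_pos _).le,
      NNReal.coe_sub hyt, Real.coe_toNNReal _ hy0, NNReal.coe_add]
    congr 1
    have : Real.exp (-(s + t)) = Real.exp (-y) * Real.exp (-(s + t - y)) := by
      rw [← Real.exp_add]
      ring_nf
    rw [this]
    ring
  have hw' : Measurable fun y : ℝ => poissonMeasure (s + t - y.toNNReal) {m} :=
    hw.comp measurable_real_toNNReal
  rw [expNN, setLIntegral_map measurableSet_Ioc hw measurable_real_toNNReal, h, expMeasure,
    gammaMeasure, setLIntegral_withDensity_eq_setLIntegral_mul _ (by exact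
      (measurable_gammaPDFReal 1 1).ennreal_ofReal) hw'
      measurableSet_Ioc, setLIntegral_congr_fun measurableSet_Ioc hcongr,
    ← ofReal_integral_eq_lintegral_ofReal, ← intervalIntegral.integral_of_le (by simp),
    poissonMeasure_singleton, ← ENNReal.ofReal_mul (Real.exp_pos _).le]
  · congr 1
    rw [intervalIntegral.integral_const_mul,
      intervalIntegral.integral_comp_sub_left (fun y => y ^ m) ((s : ℝ) + t)]
    rw [integral_pow, neg_add, Real.exp_add, Nat.factorial_succ]
    push_cast
    have : (m.factorial : ℝ) ≠ 0 := by positivity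
    field_simp
    simp
  · exact (Continuous.integrableOn_Icc (by fun_prop)).mono_set Ioc_subset_Icc_self
  · rw [EventuallyLE, ae_restrict_iff' measurableSet_Ioc]
    refine ae_of_all _ fun y hy => ?_
    have : 0 ≤ (s : ℝ) + t - y := by linarith [hy.2]
    simp only [Pi.zero_apply]
    positivity

/-- The sequence with first term `x` and subsequent terms `ω`. -/
def consSeq (x : ℝ≥0) (ω : ℕ → ℝ≥0) : ℕ → ℝ≥0
  | 0 => x
  | n + 1 => ω n

theorem measurable_consSeq :
    Measurable fun q : ℝ≥0 × (ℕ → ℝ≥0) => consSeq q.1 q.2 := by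
  refine measurable_pi_lambda _ fun n => ?_
  cases n with
  | zero => exact measurable_fst
  | succ n => exact (measurable_pi_apply n).comp measurable_snd

/-- The law of a sequence of independent standard exponential variables. -/
noncomputable def expSeq : Measure (ℕ → ℝ≥0) := Measure.infinitePi fun _ => expNN

instance : IsProbabilityMeasure expSeq := by rw [expSeq]; infer_instance

/-- An infinite product measure is determined by its values on finite boxes, and on these prepending
a coordinate only shifts the indices. -/
theorem map_consSeq :
    (expNN.prod expSeq).map (fun q => consSeq q.1 q.2) = expSeq := by
  refine Measure.eq_infinitePi _ fun s t ht => ?_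
  classical
  let t' : ℕ → Set ℝ≥0 := fun i => if i ∈ s then t i else univ
  have ht' : ∀ i, MeasurableSet (t' i) := fun i => by
    by_cases hi : i ∈ s <;> simp [t', hi, ht]
  obtain ⟨N, hN⟩ : ∃ N, s ⊆ Finset.range (N + 1) :=
    ⟨s.sup id, fun i hi => Finset.mem_range.2 (Nat.lt_succ_of_le (Finset.le_sup (f := id) hi))⟩
  have hpre : (fun q : ℝ≥0 × (ℕ → ℝ≥0) => consSeq q.1 q.2) ⁻¹' (Set.pi s t) =
      t' 0 ×ˢ Set.pi (Finset.range N) fun i => t' (i + 1) := by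
    ext ⟨x, ω⟩
    simp only [mem_preimage, Set.mem_pi, mem_prod, Finset.mem_coe, Finset.mem_range]
    constructor
    · intro h
      refine ⟨?_, fun i _ => ?_⟩
      · by_cases hi : 0 ∈ s
        · simpa [t', hi, consSeq] using h 0 hi
        · simp [t', hi]
      · by_cases hi : i + 1 ∈ s
        · simpa [t', hi, consSeq] using h (i + 1) hi
        · simp [t', hi]
    · rintro ⟨h0, h1⟩ i hi
      cases i with
      | zero => simpa [t', hi, consSeq] using h0
      | succ i =>
        have := h1 i (by simpa using hN hi)
        simpa [t', hi, consSeq] using this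
  rw [Measure.map_apply measurable_consSeq (MeasurableSet.pi s.countable_toSet fun i _ => ht i),
    hpre, Measure.prod_prod, expSeq, Measure.infinitePi_pi _ fun i _ => ht' (i + 1), mul_comm,
    ← Finset.prod_range_succ' (fun i => expNN (t' i)), ← Finset.prod_subset hN]
  · exact Finset.prod_congr rfl fun i hi => by simp [t', hi]
  · intro i _ hi
    simp [t', hi]

theorem expSeq_apply {A : Set (ℕ → ℝ≥0)} (hA : MeasurableSet A) :
    expSeq A = ∫⁻ x, expSeq (consSeq x ⁻¹' A) ∂expNN := by
  conv_lhs => rw [← map_consSeq]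
  rw [Measure.map_apply measurable_consSeq hA, Measure.prod_apply (measurable_consSeq hA)]
  rfl

/-- The time of the `n`-th event, given the sequence of waiting times. -/
def arrival (n : ℕ) (ω : ℕ → ℝ≥0) : ℝ≥0 := ∑ i ∈ Finset.range n, ω i

theorem arrival_consSeq (n : ℕ) (x : ℝ≥0) (ω : ℕ → ℝ≥0) :
    arrival (n + 1) (consSeq x ω) = x + arrival n ω := by
  rw [arrival, Finset.sum_range_succ', add_comm]
  rfl

theorem measurable_arrival (n : ℕ) : Measurable (arrival n) :=
  Finset.measurable_fun_sum _ fun i _ => measurable_pi_apply i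

theorem monotone_arrival (ω : ℕ → ℝ≥0) : Monotone fun n => arrival n ω :=
  fun _ _ h => Finset.sum_le_sum_of_subset (Finset.range_mono h)

/-- The sequences of waiting times with only finitely many events in finite time. -/
def nonexplosive : Set (ℕ → ℝ≥0) := {ω | ∀ k : ℕ, ∃ n, (k : ℝ≥0) < arrival (n + 1) ω}

theorem measurableSet_nonexplosive : MeasurableSet nonexplosive := by
  have : nonexplosive = ⋂ k : ℕ, ⋃ n, {ω | (k : ℝ≥0) < arrival (n + 1) ω} := by
    ext ω
    simp [nonexplosive]
  rw [this]
  exact MeasurableSet.iInter fun k => MeasurableSet.iUnion fun n =>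
    measurableSet_lt measurable_const (measurable_arrival _)

/-- Let `q` be the probability that all arrivals are at most `t`. Conditioning on the first waiting
time gives `q ≤ expNN (Iic t) * q` with a factor below 1, so `q = 0`. -/
theorem expSeq_nonexplosive_compl : expSeq nonexplosiveᶜ = 0 := by
  have hF : ∀ t : ℝ≥0, expSeq {ω | ∀ n, arrival (n + 1) ω ≤ t} = 0 := by
    intro t
    set A : Set (ℕ → ℝ≥0) := {ω | ∀ n, arrival (n + 1) ω ≤ t} with hAdef
    have hA : MeasurableSet A := by
      have : A = ⋂ n, {ω | arrival (n + 1) ω ≤ t} := by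
        ext ω
        simp [hAdef]
      rw [this]
      exact MeasurableSet.iInter fun n =>
        measurableSet_le (measurable_arrival _) measurable_const
    have hle : expSeq A ≤ expNN (Iic t) * expSeq A := by
      conv_lhs => rw [expSeq_apply hA]
      rw [mul_comm, ← lintegral_indicator_const measurableSet_Iic]
      refine lintegral_mono fun x => ?_
      by_cases hx : x ≤ t
      · rw [indicator_of_mem (show x ∈ Iic t from hx)]
        refine measure_mono fun ω hω n => ?_
        have := hω (n + 1)
        rw [arrival_consSeq] at this
        exact le_add_self.trans this
      · have : consSeq x ⁻¹' A = ∅ := by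
          ext ω
          simp only [mem_preimage, mem_empty_iff_false, iff_false]
          intro hω
          have := hω 0
          rw [arrival_consSeq] at this
          exact hx (le_self_add.trans this)
        rw [this]
        simp
    by_contra h0
    refine absurd hle (not_le.2 ?_)
    calc expNN (Iic t) * expSeq A < 1 * expSeq A :=
          ENNReal.mul_lt_mul_left h0 (measure_ne_top _ _) (expNN_Iic_lt_one t)
      _ = expSeq A := one_mul _
  refine measure_mono_null (t := ⋃ k : ℕ, {ω | ∀ n, arrival (n + 1) ω ≤ (k : ℝ≥0)}) ?_
    (measure_iUnion_null fun k => hF k)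
  intro ω hω
  simpa [nonexplosive] using hω

theorem consSeq_mem_nonexplosive {x : ℝ≥0} {ω : ℕ → ℝ≥0} :
    consSeq x ω ∈ nonexplosive ↔ ω ∈ nonexplosive := by
  constructor
  · intro h k
    obtain ⟨K, hK⟩ := exists_nat_ge ((k : ℝ≥0) + x)
    obtain ⟨n, hn⟩ := h K
    rw [arrival_consSeq] at hn
    refine ⟨n, lt_of_lt_of_le ?_ (monotone_arrival ω n.le_succ)⟩
    have := hK.trans_lt hn
    rw [add_comm x] at this
    exact lt_of_add_lt_add_right this
  · intro h k
    obtain ⟨n, hn⟩ := h k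
    refine ⟨n + 1, ?_⟩
    rw [arrival_consSeq]
    exact hn.trans_le le_add_self

/-- The law of the sequence of waiting times, on the set of nonexplosive sequences. -/
noncomputable def expLaw : Measure nonexplosive := expSeq.comap Subtype.val

theorem expLaw_apply' (A : Set nonexplosive) : expLaw A = expSeq (Subtype.val '' A) :=
  comap_subtype_coe_apply measurableSet_nonexplosive _ _

instance : IsProbabilityMeasure expLaw where
  measure_univ := by
    rw [expLaw_apply', image_univ, Subtype.range_coe]
    exact (prob_compl_eq_zero_iff measurableSet_nonexplosive).1 expSeq_nonexplosive_compl

/-- Prepend a waiting time to a nonexplosive sequence. -/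
def consNE (x : ℝ≥0) (ω : nonexplosive) : nonexplosive :=
  ⟨consSeq x ω, consSeq_mem_nonexplosive.2 ω.2⟩

/-- Conditioning on the first waiting time. -/
theorem expLaw_apply {A : Set nonexplosive} (hA : MeasurableSet A) :
    expLaw A = ∫⁻ x, expLaw (consNE x ⁻¹' A) ∂expNN := by
  rw [expLaw_apply', expSeq_apply (measurableSet_nonexplosive.subtype_image hA)]
  refine lintegral_congr fun x => ?_
  rw [expLaw_apply']
  congr 1
  ext ω
  simp only [mem_preimage, mem_image, Subtype.exists, exists_and_right, exists_eq_right]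
  constructor
  · rintro ⟨h, hω⟩
    exact ⟨consSeq_mem_nonexplosive.1 h, hω⟩
  · rintro ⟨h, hω⟩
    exact ⟨consSeq_mem_nonexplosive.2 h, hω⟩

theorem exists_lt_arrival (ω : nonexplosive) (t : ℝ≥0) : ∃ n, t < arrival (n + 1) ω := by
  obtain ⟨k, hk⟩ := exists_nat_ge t
  obtain ⟨n, hn⟩ := ω.2 k
  exact ⟨n, hk.trans_lt hn⟩

open Classical in
/-- The standard Poisson process: the number of events up to time `t`. -/
noncomputable def poissonCount (t : ℝ≥0) (ω : nonexplosive) : ℕ := Nat.find (exists_lt_arrival ω t)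

theorem poissonCount_le_iff {t : ℝ≥0} {ω : nonexplosive} {n : ℕ} :
    poissonCount t ω ≤ n ↔ t < arrival (n + 1) ω := by
  classical
  rw [poissonCount, Nat.find_le_iff]
  constructor
  · rintro ⟨m, hm, h⟩
    exact h.trans_le (monotone_arrival ω (Nat.succ_le_succ hm))
  · exact fun h => ⟨n, le_rfl, h⟩

theorem measurable_poissonCount (t : ℝ≥0) : Measurable (poissonCount t) := by
  classical
  exact measurable_find _ fun k => measurableSet_lt measurable_const
    ((measurable_arrival (k + 1)).comp measurable_subtype_coe)

theorem monotone_poissonCount (ω : nonexplosive) : Monotone fun t => poissonCount t ω :=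
  fun _ _ h => poissonCount_le_iff.2 (h.trans_lt (poissonCount_le_iff.1 le_rfl))

/-- The next arrival is strictly later than `t`; the strict inequality in `poissonCount` is what
makes the count right continuous. -/
theorem eventually_poissonCount_eq (ω : nonexplosive) (t : ℝ≥0) :
    ∀ᶠ u in 𝓝[≥] t, poissonCount u ω = poissonCount t ω := by
  have h : t < arrival (poissonCount t ω + 1) ω := poissonCount_le_iff.1 le_rfl
  filter_upwards [self_mem_nhdsWithin, mem_nhdsWithin_of_mem_nhds (Iio_mem_nhds h)] with u h1 h2
  exact le_antisymm (poissonCount_le_iff.2 h2) (monotone_poissonCount ω h1)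

theorem poissonCount_consNE_of_lt {r x : ℝ≥0} (h : r < x) (ω : nonexplosive) :
    poissonCount r (consNE x ω) = 0 := by
  rw [← Nat.le_zero, poissonCount_le_iff]
  change r < arrival (0 + 1) (consSeq x ω)
  rw [arrival_consSeq]
  exact h.trans_le le_self_add

/-- The renewal identity: after the first event, at time `x`, the count restarts. -/
theorem poissonCount_consNE_of_le {r x : ℝ≥0} (h : x ≤ r) (ω : nonexplosive) :
    poissonCount r (consNE x ω) = poissonCount (r - x) ω + 1 := by
  refine eq_of_forall_ge_iff fun n => ?_
  rw [poissonCount_le_iff]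
  change r < arrival (n + 1) (consSeq x ω) ↔ _
  rw [arrival_consSeq]
  cases n with
  | zero => simpa [arrival] using h
  | succ n =>
    rw [Nat.succ_le_succ_iff, poissonCount_le_iff, tsub_lt_iff_left h]

end PoissonProcess

end HeatMarkov

namespace HeatMarkov

/-! ### Independent Poisson increments -/

section PoissonProcess

theorem measurable_firstArrival : Measurable fun ω : nonexplosive => (ω : ℕ → ℝ≥0) 0 :=
  (measurable_pi_apply 0).comp measurable_subtype_coe

theorem consNE_zero (x : ℝ≥0) (ω : nonexplosive) : (consNE x ω : ℕ → ℝ≥0) 0 = x := rfl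

theorem expLaw_lt_firstArrival (u : ℝ≥0) :
    expLaw {ω : nonexplosive | u < (ω : ℕ → ℝ≥0) 0} = ENNReal.ofReal (Real.exp (-u)) := by
  have hm : MeasurableSet {ω : nonexplosive | u < (ω : ℕ → ℝ≥0) 0} :=
    measurableSet_lt measurable_const measurable_firstArrival
  rw [expLaw_apply hm, ← expNN_Ioi, ← lintegral_indicator_one measurableSet_Ioi]
  refine lintegral_congr fun x => ?_
  by_cases hx : u < x
  · rw [indicator_of_mem (show x ∈ Ioi u from hx)]
    simp [consNE_zero, hx]
  · rw [indicator_of_notMem (show x ∉ Ioi u from hx)]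
    simp [consNE_zero, hx]

theorem ae_firstArrival_pos : ∀ᵐ ω : nonexplosive ∂expLaw, 0 < (ω : ℕ → ℝ≥0) 0 := by
  refine (mem_ae_iff_prob_eq_one (measurableSet_lt measurable_const measurable_firstArrival)).2 ?_
  rw [expLaw_lt_firstArrival]
  simp

theorem measurableSet_poissonCount_eq (t : ℝ≥0) (m : ℕ) :
    MeasurableSet {ω | poissonCount t ω = m} :=
  measurable_poissonCount t (measurableSet_singleton m)

/-- The memoryless property, for the number of events after the time `s`, on the event that
there is none before. -/
theorem expLaw_lt_firstArrival_inter (m : ℕ) : ∀ s t : ℝ≥0,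
    expLaw {ω : nonexplosive | s < (ω : ℕ → ℝ≥0) 0 ∧ poissonCount (s + t) ω = m} =
      ENNReal.ofReal (Real.exp (-s)) * poissonMeasure t {m} := by
  induction m with
  | zero =>
    intro s t
    have : {ω : nonexplosive | s < (ω : ℕ → ℝ≥0) 0 ∧ poissonCount (s + t) ω = 0} =
        {ω : nonexplosive | s + t < (ω : ℕ → ℝ≥0) 0} := by
      ext ω
      simp only [mem_ofPred_eq]
      rw [← Nat.le_zero, poissonCount_le_iff]
      have h : arrival (0 + 1) (ω : ℕ → ℝ≥0) = (ω : ℕ → ℝ≥0) 0 := by simp [arrival]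
      rw [h]
      exact ⟨fun h => h.2, fun h => ⟨le_self_add.trans_lt h, h⟩⟩
    rw [this, expLaw_lt_firstArrival, poissonMeasure_singleton,
      ← ENNReal.ofReal_mul (Real.exp_pos _).le]
    congr 1
    rw [NNReal.coe_add, neg_add, Real.exp_add]
    simp
  | succ m ih =>
    intro s t
    have hm : MeasurableSet
        {ω : nonexplosive | s < (ω : ℕ → ℝ≥0) 0 ∧ poissonCount (s + t) ω = m + 1} :=
      (measurableSet_lt measurable_const measurable_firstArrival).inter
        (measurableSet_poissonCount_eq _ _)
    -- The induction hypothesis at `s = 0`; its condition that the first arrival be positive holds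
    -- almost surely.
    have h0 : ∀ u, expLaw {ω | poissonCount u ω = m} = poissonMeasure u {m} := by
      intro u
      have := ih 0 u
      simp only [zero_add, NNReal.coe_zero, neg_zero, Real.exp_zero, ENNReal.ofReal_one,
        one_mul] at this
      rw [← this]
      refine measure_congr ?_
      filter_upwards [ae_firstArrival_pos] with ω hω
      exact propext ⟨fun h => ⟨hω, h⟩, fun h => h.2⟩
    rw [expLaw_apply hm, ← setLIntegral_expNN_poissonMeasure,
      ← lintegral_indicator measurableSet_Ioc]
    refine lintegral_congr fun x => ?_
    by_cases hx : x ∈ Ioc s (s + t)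
    · rw [indicator_of_mem hx, ← h0]
      congr 1
      ext ω
      simp only [mem_preimage, mem_ofPred_eq, consNE_zero, hx.1, true_and,
        poissonCount_consNE_of_le hx.2, Nat.succ_inj]
    · rw [indicator_of_notMem hx]
      convert measure_empty (μ := expLaw)
      ext ω
      simp only [mem_preimage, mem_ofPred_eq, consNE_zero, mem_empty_iff_false, iff_false]
      rintro ⟨h1, h2⟩
      have h3 : s + t < x := not_le.1 fun h => hx ⟨h1, h⟩
      rw [poissonCount_consNE_of_lt h3] at h2
      exact Nat.succ_ne_zero m h2.symm

theorem expLaw_poissonCount_eq (t : ℝ≥0) (m : ℕ) :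
    expLaw {ω | poissonCount t ω = m} = poissonMeasure t {m} := by
  have := expLaw_lt_firstArrival_inter m 0 t
  simp only [zero_add, NNReal.coe_zero, neg_zero, Real.exp_zero, ENNReal.ofReal_one,
    one_mul] at this
  rw [← this]
  refine measure_congr ?_
  filter_upwards [ae_firstArrival_pos] with ω hω
  exact propext ⟨fun h => ⟨hω, h⟩, fun h => h.2⟩

/-- Sets in the σ-algebra generated by a family of maps do not separate points on which all these
maps agree. -/
theorem mem_iff_mem_of_measurableSet_iSup_comap {Ω ι E : Type*} [MeasurableSpace E]
    {X : ι → Ω → E} {p : ι → Prop} {A : Set Ω}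
    (hA : MeasurableSet[⨆ i, ⨆ _ : p i, MeasurableSpace.comap (X i) inferInstance] A) {ω ω' : Ω}
    (h : ∀ i, p i → X i ω = X i ω') : ω ∈ A ↔ ω' ∈ A := by
  -- The sets that do not separate `ω` from `ω'` form a σ-algebra, so it suffices to check the
  -- generators.
  let M : MeasurableSpace Ω :=
    { MeasurableSet' := fun A => ω ∈ A ↔ ω' ∈ A
      measurableSet_empty := by simp
      measurableSet_compl := fun A hA => by simpa using not_congr hA
      measurableSet_iUnion := fun f hf => by simp [hf] }
  have : (⨆ i, ⨆ _ : p i, MeasurableSpace.comap (X i) inferInstance) ≤ M := by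
    refine iSup₂_le fun i hi => ?_
    rintro _ ⟨B, -, rfl⟩
    change X i ω ∈ B ↔ X i ω' ∈ B
    rw [h i hi]
  exact this A hA

/-- With the first arrival fixed at `x`, counts before `x` are constant, and a count at `r ≥ x` is a
function of the restarted count at `r - x`. -/
theorem measurableSet_consNE_preimage {s : ℝ≥0} (x : ℝ≥0) {A : Set nonexplosive}
    (hA : MeasurableSet[pathFiltration poissonCount measurable_poissonCount s] A) :
    MeasurableSet[pathFiltration poissonCount measurable_poissonCount (s - x)]
      (consNE x ⁻¹' A) := by
  have : pathFiltration poissonCount measurable_poissonCount s ≤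
      (pathFiltration poissonCount measurable_poissonCount (s - x)).map (consNE x) := by
    refine iSup₂_le fun r hr => ?_
    rintro _ ⟨B, -, rfl⟩
    change MeasurableSet[pathFiltration poissonCount measurable_poissonCount (s - x)]
      (consNE x ⁻¹' (poissonCount r ⁻¹' B))
    by_cases hrx : r < x
    · have : consNE x ⁻¹' (poissonCount r ⁻¹' B) = {_ω | (0 : ℕ) ∈ B} := by
        ext ω
        simp only [mem_preimage, poissonCount_consNE_of_lt hrx, mem_ofPred_eq]
      rw [this]
      exact MeasurableSet.const _
    · have : consNE x ⁻¹' (poissonCount r ⁻¹' B) =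
          poissonCount (r - x) ⁻¹' {n | n + 1 ∈ B} := by
        ext ω
        simp only [mem_preimage, poissonCount_consNE_of_le (not_lt.1 hrx), mem_ofPred_eq]
      rw [this]
      exact le_biSup (fun r => MeasurableSpace.comap (poissonCount r) _)
        (tsub_le_tsub_right hr x) _ ⟨_, MeasurableSet.of_discrete, rfl⟩
  exact this A hA

/-- Induction on the count at time `s`. If it is 0, the past carries no information, so `A` contains
all or none of that event and memorylessness applies. Otherwise conditioning on the first arrival `x
≤ s` lowers the count by one and replaces `s` by `s - x`. -/
theorem expLaw_inter_poissonCount_eq_inter (n : ℕ) : ∀ (s t : ℝ≥0) (m : ℕ)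
    {A : Set nonexplosive},
    MeasurableSet[pathFiltration poissonCount measurable_poissonCount s] A →
    expLaw (A ∩ {ω | poissonCount s ω = n} ∩ {ω | poissonCount (s + t) ω = n + m}) =
      expLaw (A ∩ {ω | poissonCount s ω = n}) * poissonMeasure t {m} := by
  induction n with
  | zero =>
    intro s t m A hA
    have h0 : ∀ ω : nonexplosive, poissonCount s ω = 0 ↔ s < (ω : ℕ → ℝ≥0) 0 := by
      intro ω
      rw [← Nat.le_zero, poissonCount_le_iff]
      simp [arrival]
    by_cases hne : (A ∩ {ω | poissonCount s ω = 0}).Nonempty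
    · obtain ⟨ω₀, hω₀, h1⟩ := hne
      have hsub : A ∩ {ω | poissonCount s ω = 0} =
          {ω : nonexplosive | s < (ω : ℕ → ℝ≥0) 0} := by
        ext ω
        simp only [mem_inter_iff, mem_ofPred_eq, ← h0, and_iff_right_iff_imp]
        intro hω
        refine (mem_iff_mem_of_measurableSet_iSup_comap hA fun r hr => ?_).1 hω₀
        have e1 : poissonCount r ω₀ = 0 :=
          Nat.le_zero.1 ((monotone_poissonCount ω₀ hr).trans (le_of_eq h1))
        have e2 : poissonCount r ω = 0 :=
          Nat.le_zero.1 ((monotone_poissonCount ω hr).trans (le_of_eq hω))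
        rw [e1, e2]
      rw [hsub, expLaw_lt_firstArrival, ← expLaw_lt_firstArrival_inter, zero_add]
      rfl
    · rw [not_nonempty_iff_eq_empty.1 hne]
      simp
  | succ n ih =>
    intro s t m A hA
    have hAm := (pathFiltration poissonCount measurable_poissonCount).le s A hA
    have h1 := hAm.inter (measurableSet_poissonCount_eq s (n + 1))
    rw [expLaw_apply (h1.inter (measurableSet_poissonCount_eq (s + t) (n + 1 + m))),
      expLaw_apply h1, ← lintegral_mul_const' _ _ (measure_ne_top _ _)]
    refine lintegral_congr fun x => ?_
    by_cases hx : x ≤ s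
    · have e1 : consNE x ⁻¹' (A ∩ {ω | poissonCount s ω = n + 1}) =
          consNE x ⁻¹' A ∩ {ω | poissonCount (s - x) ω = n} := by
        ext ω
        simp only [mem_preimage, mem_inter_iff, mem_ofPred_eq, poissonCount_consNE_of_le hx,
          Nat.succ_inj]
      have e2 : consNE x ⁻¹' {ω | poissonCount (s + t) ω = n + 1 + m} =
          {ω | poissonCount (s - x + t) ω = n + m} := by
        ext ω
        simp only [mem_preimage, mem_ofPred_eq]
        rw [poissonCount_consNE_of_le (hx.trans le_self_add), tsub_add_eq_add_tsub hx]
        omega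
      rw [preimage_inter, e1, e2]
      exact ih (s - x) t m (measurableSet_consNE_preimage x hA)
    · have e1 : consNE x ⁻¹' (A ∩ {ω | poissonCount s ω = n + 1}) = ∅ := by
        ext ω
        simp [poissonCount_consNE_of_lt (not_le.1 hx)]
      rw [preimage_inter, e1]
      simp

/-- The increments of the Poisson process are stationary, Poisson distributed and independent of
the past. -/
theorem expLaw_inter_poissonCount_increment (s t : ℝ≥0) (m : ℕ) {A : Set nonexplosive}
    (hA : MeasurableSet[pathFiltration poissonCount measurable_poissonCount s] A) :
    expLaw (A ∩ {ω | poissonCount (s + t) ω = poissonCount s ω + m}) =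
      expLaw A * poissonMeasure t {m} := by
  have hAm := (pathFiltration poissonCount measurable_poissonCount).le s A hA
  have hU : A = ⋃ n, A ∩ {ω | poissonCount s ω = n} := by
    rw [← inter_iUnion]
    ext ω
    simp
  have hd : Pairwise (Function.onFun Disjoint fun n => A ∩ {ω | poissonCount s ω = n}) := by
    intro i j hij
    rw [Function.onFun, Set.disjoint_left]
    rintro ω ⟨-, h1⟩ ⟨-, h2⟩
    exact hij (h1.symm.trans h2)
  have hU2 : A ∩ {ω | poissonCount (s + t) ω = poissonCount s ω + m} =
      ⋃ n, A ∩ {ω | poissonCount s ω = n} ∩ {ω | poissonCount (s + t) ω = n + m} := by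
    ext ω
    simp only [mem_inter_iff, mem_ofPred_eq, mem_iUnion]
    constructor
    · rintro ⟨h1, h2⟩
      exact ⟨_, ⟨h1, rfl⟩, h2⟩
    · rintro ⟨n, ⟨h1, rfl⟩, h2⟩
      exact ⟨h1, h2⟩
  have hm : ∀ n, MeasurableSet (A ∩ {ω | poissonCount s ω = n}) := fun n =>
    hAm.inter (measurableSet_poissonCount_eq s n)
  rw [hU2, measure_iUnion (fun i j hij => (hd hij).mono inter_subset_left inter_subset_left)
    fun n => (hm n).inter (measurableSet_poissonCount_eq _ _)]
  conv_rhs => rw [hU]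
  rw [measure_iUnion hd hm, ← ENNReal.tsum_mul_right]
  exact tsum_congr fun n => expLaw_inter_poissonCount_eq_inter n s t m hA

end PoissonProcess

end HeatMarkov

namespace HeatMarkov

/-! ### The chain run by the Poisson clock -/

section Subordination

variable {Z : Type*} [MeasurableSpace Z]

/-- The state at time `t` of the continuous-time process which follows the sequence `ω.1` and jumps
at the times of a Poisson process of rate `c`. -/
noncomputable def jumpProcess (c : ℝ≥0) (t : ℝ≥0) (ω : (ℕ → Z) × nonexplosive) : Z :=
  ω.1 (poissonCount (c * t) ω.2)

/-- The law of a Markov chain together with an independent Poisson process. -/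
noncomputable def jumpLaw (κ : Kernel Z Z) [IsMarkovKernel κ] :
    Kernel Z ((ℕ → Z) × nonexplosive) :=
  chainKernel κ ×ₖ Kernel.const Z expLaw

instance (κ : Kernel Z Z) [IsMarkovKernel κ] : IsMarkovKernel (jumpLaw κ) := by
  rw [jumpLaw]; infer_instance

theorem jumpLaw_apply (κ : Kernel Z Z) [IsMarkovKernel κ] (z : Z) :
    jumpLaw κ z = (chainKernel κ z).prod expLaw := by
  rw [jumpLaw, Kernel.prod_apply, Kernel.const_apply]

theorem measurable_eval_nat : Measurable fun q : (ℕ → Z) × ℕ => q.1 q.2 :=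
  measurable_from_prod_countable_left fun n => measurable_pi_apply n

theorem measurable_jumpProcess (c t : ℝ≥0) :
    Measurable (jumpProcess c t : (ℕ → Z) × nonexplosive → Z) :=
  measurable_eval_nat.comp
    (measurable_fst.prodMk ((measurable_poissonCount (c * t)).comp measurable_snd))

/-- The transition kernels of the process which jumps at rate `c` according to `κ`. -/
noncomputable def jumpTransition (κ : Kernel Z Z) [IsMarkovKernel κ] (c t : ℝ≥0) : Kernel Z Z :=
  (jumpLaw κ).map (jumpProcess c t)

instance (κ : Kernel Z Z) [IsMarkovKernel κ] (c t : ℝ≥0) :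
    IsMarkovKernel (jumpTransition κ c t) :=
  Kernel.IsMarkovKernel.map _ (measurable_jumpProcess c t)

/-- The events before time `s` are determined by the whole chain and the Poisson process before
time `s`. -/
theorem measurableSet_prod_of_pathFiltration {c s : ℝ≥0} {A : Set ((ℕ → Z) × nonexplosive)}
    (hA : MeasurableSet[pathFiltration (jumpProcess c) (measurable_jumpProcess c) s] A) :
    MeasurableSet[MeasurableSpace.prod MeasurableSpace.pi
      (pathFiltration poissonCount measurable_poissonCount (c * s))] A := by
  have : (pathFiltration (jumpProcess c) (measurable_jumpProcess c) s :
      MeasurableSpace ((ℕ → Z) × nonexplosive)) ≤ MeasurableSpace.prod MeasurableSpace.pi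
      (pathFiltration poissonCount measurable_poissonCount (c * s)) := by
    refine iSup₂_le fun r hr => ?_
    rw [← measurable_iff_comap_le]
    let _ : MeasurableSpace nonexplosive :=
      pathFiltration poissonCount measurable_poissonCount (c * s)
    have h1 : Measurable (poissonCount (c * r)) :=
      measurable_pathFiltration measurable_poissonCount (by gcongr : c * r ≤ c * s)
    exact measurable_eval_nat.comp (measurable_fst.prodMk (h1.comp measurable_snd))
  exact this A hA

/-- Given the Poisson process, the events before time `s` are determined by the steps of the chain
up to the number of jumps before time `s`. -/
theorem measurableSet_section_of_pathFiltration {c s : ℝ≥0} {A : Set ((ℕ → Z) × nonexplosive)}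
    (hA : MeasurableSet[pathFiltration (jumpProcess c) (measurable_jumpProcess c) s] A)
    (ω : nonexplosive) :
    MeasurableSet[⨆ i ≤ poissonCount (c * s) ω,
      MeasurableSpace.comap (fun x : ℕ → Z => x i) inferInstance] {x | (x, ω) ∈ A} := by
  have : (pathFiltration (jumpProcess c) (measurable_jumpProcess c) s :
      MeasurableSpace ((ℕ → Z) × nonexplosive)) ≤ MeasurableSpace.map (fun x => (x, ω))
      (⨆ i ≤ poissonCount (c * s) ω,
        MeasurableSpace.comap (fun x : ℕ → Z => x i) inferInstance) := by
    refine iSup₂_le fun r hr => ?_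
    rintro _ ⟨B, hB, rfl⟩
    have hle : poissonCount (c * r) ω ≤ poissonCount (c * s) ω :=
      monotone_poissonCount ω (by gcongr)
    have h : MeasurableSpace.comap (fun x : ℕ → Z => x (poissonCount (c * r) ω)) inferInstance ≤
        ⨆ i ≤ poissonCount (c * s) ω,
          MeasurableSpace.comap (fun x : ℕ → Z => x i) inferInstance :=
      le_iSup₂_of_le (poissonCount (c * r) ω) hle le_rfl
    exact h _ ⟨B, hB, rfl⟩
  exact this A hA

theorem lintegral_eq_tsum_setLIntegral_fiber {Ω : Type*} [MeasurableSpace Ω] (μ : Measure Ω)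
    {D : Ω → ℕ} (hD : Measurable D) (g : Ω → ℝ≥0∞) :
    ∫⁻ ω, g ω ∂μ = ∑' m, ∫⁻ ω in {ω | D ω = m}, g ω ∂μ := by
  rw [← lintegral_iUnion (s := fun m => {ω | D ω = m}) (fun m => hD (measurableSet_singleton m))]
  · have : ⋃ m, {ω | D ω = m} = univ := by
      ext ω
      simp
    rw [this, Measure.restrict_univ]
  · intro i j hij
    rw [Function.onFun, Set.disjoint_left]
    intro ω h1 h2
    exact hij (Eq.trans (Eq.symm h1) h2)

variable (κ : Kernel Z Z) [IsMarkovKernel κ] (c : ℝ≥0)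

theorem chainKernel_apply_eval (z : Z) (m : ℕ) {B : Set Z} (hB : MeasurableSet B) :
    chainKernel κ z {x | x m ∈ B} = kernelPow κ m z B := by
  have h := chainKernel_markov κ z m 0 MeasurableSet.univ hB
  have hmap : (chainKernel κ z).map (fun x => x 0) = Measure.dirac z := by
    ext B hB
    rw [Measure.map_apply (measurable_pi_apply 0) hB, ← chainKernel_zero κ z hB]
    rfl
  rw [univ_inter, zero_add, Measure.restrict_univ] at h
  rw [h, ← lintegral_map (f := fun y => kernelPow κ m y B) ((kernelPow κ m).measurable_coe hB)
    (measurable_pi_apply 0), hmap, lintegral_dirac' _ ((kernelPow κ m).measurable_coe hB)]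

theorem jumpTransition_apply (t : ℝ≥0) (z : Z) {B : Set Z} (hB : MeasurableSet B) :
    jumpTransition κ c t z B = ∑' m, poissonMeasure (c * t) {m} * kernelPow κ m z B := by
  have hm := measurable_jumpProcess (Z := Z) c t hB
  rw [jumpTransition, Kernel.map_apply' _ (measurable_jumpProcess c t) _ hB, jumpLaw_apply,
    Measure.prod_apply_symm hm,
    lintegral_eq_tsum_setLIntegral_fiber _ (measurable_poissonCount (c * t))]
  refine tsum_congr fun m => ?_
  have : ∀ ω ∈ {ω | poissonCount (c * t) ω = m},
      chainKernel κ z ((fun x => (x, ω)) ⁻¹' (jumpProcess c t ⁻¹' B)) = kernelPow κ m z B := by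
    intro ω hω
    rw [← chainKernel_apply_eval κ z m hB]
    congr 1
    ext x
    simp only [mem_preimage, jumpProcess, mem_ofPred_eq]
    rw [show poissonCount (c * t) ω = m from hω]
  rw [setLIntegral_congr_fun (measurableSet_poissonCount_eq _ _) this, setLIntegral_const,
    expLaw_poissonCount_eq, mul_comm]

theorem jumpTransition_apply_eq_sum (t : ℝ≥0) (z : Z) :
    jumpTransition κ c t z =
      Measure.sum fun m => poissonMeasure (c * t) {m} • kernelPow κ m z := by
  ext B hB
  rw [jumpTransition_apply κ c t z hB, Measure.sum_apply _ hB]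
  rfl

/-- Independence of the increment passes from events to functions: restricted to the σ-algebra of
the past, the two measures being integrated coincide. -/
theorem setLIntegral_poissonCount_increment (s t : ℝ≥0) (m : ℕ) {g : nonexplosive → ℝ≥0∞}
    (hg : Measurable[pathFiltration poissonCount measurable_poissonCount s] g) :
    ∫⁻ ω in {ω | poissonCount (s + t) ω - poissonCount s ω = m}, g ω ∂expLaw =
      poissonMeasure t {m} * ∫⁻ ω, g ω ∂expLaw := by
  have hle := (pathFiltration poissonCount measurable_poissonCount).le s
  rw [← lintegral_trim hle hg, ← lintegral_trim hle hg, ← smul_eq_mul, ← lintegral_smul_measure]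
  congr 1
  refine @Measure.ext _ (pathFiltration poissonCount measurable_poissonCount s) _ _ fun A hA => ?_
  rw [trim_measurableSet_eq hle hA, Measure.restrict_apply (hle A hA), Measure.smul_apply,
    trim_measurableSet_eq hle hA, smul_eq_mul, mul_comm,
    ← expLaw_inter_poissonCount_increment s t m hA]
  congr 1
  ext ω
  have := monotone_poissonCount ω (le_self_add : s ≤ s + t)
  simp only [mem_inter_iff, mem_ofPred_eq]
  refine and_congr_right fun _ => ?_
  simp only at this
  omega

omit [IsMarkovKernel κ] in
theorem measurable_kernelPow_apply {B : Set Z} (hB : MeasurableSet B) :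
    Measurable fun q : ℕ × Z => kernelPow κ q.1 q.2 B :=
  measurable_from_prod_countable_right fun n => (kernelPow κ n).measurable_coe hB

/-- For a fixed clock, the chain moves from its state at time `s` by as many steps as the clock
ticks in the increment, and its Markov property applies (`h1`). After exchanging the integrals, for
a fixed chain path, the increment is independent of the past of the clock, and averaging over it
gives the Poisson mixture (`h2`). -/
theorem jumpProcess_markov (z : Z) (s t : ℝ≥0) {A : Set ((ℕ → Z) × nonexplosive)}
    (hA : MeasurableSet[pathFiltration (jumpProcess c) (measurable_jumpProcess c) s] A)
    {B : Set Z} (hB : MeasurableSet B) :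
    jumpLaw κ z (A ∩ {ω | jumpProcess c (s + t) ω ∈ B}) =
      ∫⁻ ω in A, jumpTransition κ c t (jumpProcess c s ω) B ∂(jumpLaw κ z) := by
  have hAm := (pathFiltration (jumpProcess c) (measurable_jumpProcess c)).le s A hA
  have hAB : MeasurableSet (A ∩ {ω | jumpProcess c (s + t) ω ∈ B}) :=
    hAm.inter (measurable_jumpProcess c (s + t) hB)
  have hN := measurable_poissonCount (c * s)
  have hD : Measurable fun ω => poissonCount (c * s + c * t) ω - poissonCount (c * s) ω :=
    (measurable_poissonCount _).sub hN
  let G : (ℕ → Z) × nonexplosive → ℝ≥0∞ := A.indicator fun q =>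
    kernelPow κ (poissonCount (c * s + c * t) q.2 - poissonCount (c * s) q.2)
      (q.1 (poissonCount (c * s) q.2)) B
  have hG : Measurable G := by
    refine Measurable.indicator ?_ hAm
    exact (measurable_kernelPow_apply κ hB).comp ((hD.comp measurable_snd).prodMk
      (measurable_eval_nat.comp (measurable_fst.prodMk (hN.comp measurable_snd))))
  have h1 : jumpLaw κ z (A ∩ {ω | jumpProcess c (s + t) ω ∈ B}) =
      ∫⁻ ω, ∫⁻ x, G (x, ω) ∂(chainKernel κ z) ∂expLaw := by
    rw [jumpLaw_apply, Measure.prod_apply_symm hAB]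
    refine lintegral_congr fun ω => ?_
    have hsec := measurableSet_section_of_pathFiltration hA ω
    have hsecm : MeasurableSet {x | (x, ω) ∈ A} :=
      hAm.preimage (measurable_id.prodMk measurable_const)
    have := chainKernel_markov κ z
      (poissonCount (c * s + c * t) ω - poissonCount (c * s) ω) _ hsec hB
    rw [Nat.add_sub_cancel' (monotone_poissonCount ω le_self_add), ← mul_add] at this
    refine Eq.trans this ?_
    rw [← lintegral_indicator hsecm, mul_add]
    rfl
  have h2 : ∀ x : ℕ → Z, ∫⁻ ω, G (x, ω) ∂expLaw = ∫⁻ ω, A.indicator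
      (fun q => jumpTransition κ c t (jumpProcess c s q) B) (x, ω) ∂expLaw := by
    intro x
    let g : ℕ → nonexplosive → ℝ≥0∞ := fun m ω => A.indicator
      (fun q => kernelPow κ m (q.1 (poissonCount (c * s) q.2)) B) (x, ω)
    have hg : ∀ m, Measurable[pathFiltration poissonCount measurable_poissonCount (c * s)]
        (g m) := by
      intro m
      have hAp := measurableSet_prod_of_pathFiltration hA
      have hle := (pathFiltration poissonCount measurable_poissonCount).le (c * s)
      have hNs : Measurable[pathFiltration poissonCount measurable_poissonCount (c * s)]
          (poissonCount (c * s)) := measurable_pathFiltration measurable_poissonCount le_rfl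
      have hx : Measurable fun n : ℕ => kernelPow κ m (x n) B := measurable_of_countable _
      have := @measurable_prodMk_left _ _ MeasurableSpace.pi (pathFiltration poissonCount
        measurable_poissonCount (c * s)) x
      change Measurable[pathFiltration poissonCount measurable_poissonCount (c * s)]
        ((Prod.mk x ⁻¹' A).indicator fun ω => kernelPow κ m (x (poissonCount (c * s) ω)) B)
      exact Measurable.indicator (hx.comp hNs) (this hAp)
    rw [lintegral_eq_tsum_setLIntegral_fiber _ hD]
    have h3 : ∀ ω, A.indicator (fun q => jumpTransition κ c t (jumpProcess c s q) B) (x, ω) =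
        ∑' m, poissonMeasure (c * t) {m} * g m ω := by
      intro ω
      by_cases hω : (x, ω) ∈ A
      · simp only [g, indicator_of_mem hω, jumpTransition_apply κ c t _ hB, jumpProcess]
      · simp only [g, indicator_of_notMem hω, mul_zero, tsum_zero]
    have hgm : ∀ m, Measurable (g m) := fun m =>
      (hg m).mono ((pathFiltration poissonCount measurable_poissonCount).le _) le_rfl
    simp_rw [h3]
    rw [lintegral_tsum fun m => ((hgm m).const_mul _).aemeasurable]
    refine tsum_congr fun m => ?_
    rw [lintegral_const_mul _ (hgm m), ← setLIntegral_poissonCount_increment _ _ _ (hg m)]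
    refine setLIntegral_congr_fun (hD (measurableSet_singleton m)) fun ω hω => ?_
    have hω' : poissonCount (c * s + c * t) ω - poissonCount (c * s) ω = m := hω
    by_cases hωA : (x, ω) ∈ A
    · simp only [G, g, indicator_of_mem hωA, hω']
    · simp only [G, g, indicator_of_notMem hωA]
  have hT : Measurable (A.indicator
      (fun q => jumpTransition κ c t (jumpProcess c s q) B)) :=
    (((jumpTransition κ c t).measurable_coe hB).comp (measurable_jumpProcess c s)).indicator hAm
  rw [h1, lintegral_lintegral_swap (by exact (hG.comp measurable_swap).aemeasurable),
    ← lintegral_indicator hAm, jumpLaw_apply, lintegral_prod _ hT.aemeasurable]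
  exact lintegral_congr h2

theorem jumpTransition_zero (z : Z) : jumpTransition κ c 0 z = Measure.dirac z := by
  ext B hB
  rw [jumpTransition_apply κ c 0 z hB, tsum_eq_single 0]
  · simp [poissonMeasure_singleton, kernelPow, Kernel.id_apply]
  · intro m hm
    simp [poissonMeasure_singleton, hm]

theorem isTransitionFunction_jumpTransition : IsTransitionFunction (jumpTransition κ c) where
  isMarkovKernel := inferInstance
  zero := jumpTransition_zero κ c
  chapman_kolmogorov s t z B hB := by
    -- Chapman-Kolmogorov is the Markov property with the trivial past event.
    have h := jumpProcess_markov κ c z s t MeasurableSet.univ hB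
    have hm := measurable_jumpProcess (Z := Z) c
    rw [univ_inter, Measure.restrict_univ] at h
    conv_lhs => rw [jumpTransition, Kernel.map_apply' _ (hm _) _ hB]
    conv_rhs => rw [jumpTransition.eq_def κ c s, Kernel.map_apply _ (hm _),
      lintegral_map ((jumpTransition κ c t).measurable_coe hB) (hm s)]
    exact h

theorem isMarkovProcess_jumpProcess [MeasurableSingletonClass Z] :
    IsMarkovProcess (jumpTransition κ c) (jumpLaw κ) (jumpProcess c) where
  measurable := measurable_jumpProcess c
  isMarkovKernel := inferInstance
  start z := by
    have h := jumpTransition_zero κ c z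
    have h2 : ∀ᵐ y ∂(jumpTransition κ c 0 z), y = z := by
      rw [h, ae_dirac_eq]
      rfl
    rw [jumpTransition, Kernel.map_apply _ (measurable_jumpProcess c 0)] at h2
    exact ae_of_ae_map (measurable_jumpProcess c 0).aemeasurable h2
  markov z s t _ hA _ hB := jumpProcess_markov κ c z s t hA hB

omit [MeasurableSpace Z] in
theorem eventually_jumpProcess_eq (ω : (ℕ → Z) × nonexplosive) (t : ℝ≥0) :
    ∀ᶠ u in 𝓝[≥] t, jumpProcess c u ω = jumpProcess c t ω := by
  have h : Tendsto (fun u => c * u) (𝓝[≥] t) (𝓝[≥] (c * t)) := by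
    refine tendsto_nhdsWithin_iff.2 ⟨?_, ?_⟩
    · exact ((continuous_const.mul continuous_id).tendsto t).mono_left nhdsWithin_le_nhds
    · filter_upwards [self_mem_nhdsWithin] with u hu
      exact mul_le_mul_right (show t ≤ u from hu) c
  filter_upwards [h.eventually (eventually_poissonCount_eq ω.2 (c * t))] with u hu
  simp only [jumpProcess, hu]

theorem isStrongMarkovProcess_jumpProcess [MeasurableSingletonClass Z] :
    IsStrongMarkovProcess (jumpTransition κ c) (jumpLaw κ) (jumpProcess c) :=
  isStrongMarkovProcess_of_isMarkovProcess (isMarkovProcess_jumpProcess κ c) fun ω t =>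
    (eventually_jumpProcess_eq c ω t).filter_mono (nhdsWithin_mono t Ioi_subset_Ici_self)

/-- A monotone `ℕ`-valued function is constant on some left neighbourhood of every point. -/
theorem eventually_nhdsLT_eq_of_monotone {f : ℝ≥0 → ℕ} (hf : Monotone f) (t : ℝ≥0) :
    ∃ n, ∀ᶠ u in 𝓝[<] t, f u = n := by
  by_cases ht : t = 0
  · refine ⟨0, ?_⟩
    have : Iio (0 : ℝ≥0) = ∅ := by
      ext
      simp
    rw [ht, this, nhdsWithin_empty]
    exact eventually_bot
  have hne : (f '' Iio t).Nonempty := ⟨f 0, 0, pos_iff_ne_zero.2 ht, rfl⟩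
  have hbdd : BddAbove (f '' Iio t) := ⟨f t, by rintro _ ⟨u, hu, rfl⟩; exact hf (le_of_lt hu)⟩
  obtain ⟨v, hv, hvs⟩ := Nat.sSup_mem hne hbdd
  refine ⟨f v, ?_⟩
  filter_upwards [Ioo_mem_nhdsLT (show v < t from hv)] with u hu
  refine le_antisymm ?_ (hf hu.1.le)
  rw [hvs]
  exact le_csSup hbdd ⟨u, hu.2, rfl⟩

omit [MeasurableSpace Z] in
-- Just before `t` the count is constant, so the left limit is itself a state of the chain and lies
-- in `Z` for any topology.
theorem isCadlagPath_jumpProcess [TopologicalSpace Z] (ω : (ℕ → Z) × nonexplosive) :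
    IsCadlagPath fun t => jumpProcess c t ω := by
  intro t
  refine ⟨tendsto_const_nhds.congr' ((eventually_jumpProcess_eq c ω t).mono fun _ h => h.symm), ?_⟩
  have hmono : Monotone fun u : ℝ≥0 => poissonCount (c * u) ω.2 := fun _ _ h =>
    monotone_poissonCount ω.2 (by gcongr)
  obtain ⟨n, hn⟩ := eventually_nhdsLT_eq_of_monotone hmono t
  exact ⟨ω.1 n, tendsto_const_nhds.congr' (hn.mono fun u hu => by simp only [jumpProcess, hu])⟩

end Subordination

end HeatMarkov

namespace HeatMarkov

/-! ### The Cauchy problem for a bounded operator -/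

section Cauchy

variable {E : Type*} [NormedAddCommGroup E] [NormedSpace ℝ E] [CompleteSpace E]

theorem isCauchySolution_exp (L : E →L[ℝ] E) (h₀ : E) :
    IsCauchySolution L h₀ fun t : ℝ => NormedSpace.exp (t • L) h₀ := by
  have hd : ∀ t : ℝ, HasDerivAt (fun t : ℝ => NormedSpace.exp (t • L) h₀)
      (L (NormedSpace.exp (t • L) h₀)) t := fun t => by
    have := (hasDerivAt_exp_smul_const' (𝕂 := ℝ) L t).clm_apply (hasDerivAt_const t h₀)
    simpa using this
  have hc : Continuous fun t : ℝ => NormedSpace.exp (t • L) h₀ :=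
    continuous_iff_continuousAt.2 fun t => (hd t).continuousAt
  refine ⟨hc.continuousOn, ContDiff.contDiffOn ?_, fun t _ => hd t, by simp⟩
  rw [contDiff_one_iff_deriv]
  refine ⟨fun t => (hd t).differentiableAt, ?_⟩
  rw [funext fun t => (hd t).deriv]
  exact L.continuous.comp hc

theorem exp_smul_mul_exp_neg_smul (L : E →L[ℝ] E) (t : ℝ) :
    NormedSpace.exp (t • L) * NormedSpace.exp ((-t) • L) = 1 := by
  let _ : NormedAlgebra ℚ (E →L[ℝ] E) := .restrictScalars ℚ ℝ _
  rw [← NormedSpace.exp_add_of_commute (((Commute.refl L).smul_left t).smul_right (-t)),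
    ← add_smul, add_neg_cancel, zero_smul, NormedSpace.exp_zero]

/-- For a solution `h`, the function `exp (-s L) (h s)` has derivative 0 for `s > 0`.
Differentiability at 0 is not assumed, so its constant value is identified with `h₀` by continuity
from the right. -/
theorem IsCauchySolution.eq_exp {L : E →L[ℝ] E} {h₀ : E} {h : ℝ → E}
    (hh : IsCauchySolution L h₀ h) {t : ℝ} (ht : 0 ≤ t) :
    h t = NormedSpace.exp (t • L) h₀ := by
  let g : ℝ → E := fun s => NormedSpace.exp ((-s) • L) (h s)
  have he : ∀ s : ℝ, HasDerivAt (fun s : ℝ => NormedSpace.exp ((-s) • L))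
      (-(NormedSpace.exp ((-s) • L) * L)) s := fun s => by
    have := (hasDerivAt_exp_smul_const (𝕂 := ℝ) L (-s)).scomp s (hasDerivAt_neg s)
    simpa [Function.comp_def] using this
  have hg : ∀ s, 0 < s → HasDerivAt g 0 s := fun s hs => by
    convert (he s).clm_apply (hh.hasDerivAt s hs) using 1
    simp
  have hconst : ∀ a b : ℝ, 0 < a → a ≤ b → g b = g a := fun a b ha hab =>
    constant_of_has_deriv_right_zero
      (fun s hs => (hg s (ha.trans_le hs.1)).continuousAt.continuousWithinAt)
      (fun s hs => (hg s (ha.trans_le hs.1)).hasDerivWithinAt) b ⟨hab, le_rfl⟩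
  have hgt : g t = h₀ := by
    rcases ht.eq_or_lt with rfl | ht
    · simp [g, hh.initial]
    · have h0 : Tendsto g (𝓝[>] 0) (𝓝 (g 0)) := by
        have hc : ContinuousWithinAt g (Ici 0) 0 :=
          ((he 0).continuousAt.continuousWithinAt).clm_apply (hh.continuousOn 0 self_mem_Ici)
        exact hc.mono Ioi_subset_Ici_self
      have h1 : Tendsto g (𝓝[>] 0) (𝓝 (g t)) := by
        refine tendsto_const_nhds.congr' ?_
        filter_upwards [Ioo_mem_nhdsGT ht] with u hu
        exact hconst u t hu.1 hu.2.le
      rw [tendsto_nhds_unique h1 h0]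
      simp [g, hh.initial]
  have := congrArg (fun T : E →L[ℝ] E => T (h t)) (exp_smul_mul_exp_neg_smul L t)
  rw [← hgt]
  exact this.symm

/-- The exponential of `t c (A - 1)` as a Poisson average of the powers of `A`. -/
theorem hasSum_exp_smul_sub_one (A : E →L[ℝ] E) (r : ℝ≥0) (h : E) :
    HasSum (fun n => (poissonMeasure r).real {n} • (A ^ n) h)
      (NormedSpace.exp ((r : ℝ) • (A - 1)) h) := by
  let _ : NormedAlgebra ℚ (E →L[ℝ] E) := .restrictScalars ℚ ℝ _
  -- The scalar `-r` commutes with `A`; its exponential normalises the series to Poisson weights.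
  have h1 : NormedSpace.exp ((r : ℝ) • (A - 1)) =
      Real.exp (-r) • NormedSpace.exp ((r : ℝ) • A) := by
    have e1 : (r : ℝ) • (A - 1) = algebraMap ℝ (E →L[ℝ] E) (-r) + (r : ℝ) • A := by
      rw [Algebra.algebraMap_eq_smul_one, smul_sub, neg_smul]
      abel
    rw [e1, NormedSpace.exp_add_of_commute (Algebra.commutes _ _),
      ← NormedSpace.algebraMap_exp_comm, ← Real.exp_eq_exp_ℝ, ← Algebra.smul_def]
  have h2 := NormedSpace.exp_series_hasSum_exp' (𝕂 := ℝ) ((r : ℝ) • A)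
  have h3 := (h2.mapL (ContinuousLinearMap.apply ℝ E h)).const_smul (Real.exp (-r))
  rw [h1]
  convert h3 using 1
  · ext n
    simp only [poissonMeasure_real_singleton, ContinuousLinearMap.apply_apply, smul_pow,
      smul_apply, smul_smul]
    congr 1
    ring
  · rfl

end Cauchy

end HeatMarkov

namespace HeatMarkov

/-! ### From the bounded Laplacian to a Markov kernel -/

section JumpKernel

variable {Z : Type*} [MeasurableSpace Z]

open Classical in
/-- The kernel `k`, set to zero on the diagonal at the atoms of `ν`. -/
noncomputable def offDiag (ν : Measure Z) (k : Z → Z → ℝ≥0) (z y : Z) : ℝ≥0 :=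
  if z = y ∧ ν {z} ≠ 0 then 0 else k z y

theorem offDiag_of_ne (ν : Measure Z) (k : Z → Z → ℝ≥0) {z y : Z} (h : z ≠ y) :
    offDiag ν k z y = k z y := if_neg fun h' => h h'.1

/-- An s-finite measure has countably many atoms, so `k` is changed at countably many points only.
The diagonal itself need not be measurable in the product σ-algebra. -/
theorem measurable_offDiag [MeasurableSingletonClass Z] (ν : Measure Z) [SFinite ν]
    {k : Z → Z → ℝ≥0} (hk : Measurable (Function.uncurry k)) :
    Measurable (Function.uncurry (offDiag ν k)) := by
  refine hk.measurable_of_countable_ne ?_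
  have hc : {z : Z | 0 < ν {z}}.Countable :=
    Measure.countable_meas_pos_of_disjoint_iUnion (fun z => measurableSet_singleton z)
      fun a b hab => disjoint_singleton.2 hab
  refine (hc.image fun z => (z, z)).mono ?_
  rintro ⟨z, y⟩ h
  have h' : z = y ∧ ν {z} ≠ 0 := by
    by_contra hne
    exact h (if_neg hne).symm
  obtain ⟨rfl, h2⟩ := h'
  exact ⟨z, pos_iff_ne_zero.2 h2, rfl⟩

theorem degree_offDiag [MeasurableSingletonClass Z] (ν : Measure Z) (k : Z → Z → ℝ≥0) (z : Z) :
    degree ν (offDiag ν k) z = ∫⁻ y in {z}ᶜ, (k z y : ℝ≥0∞) ∂ν := by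
  rw [degree, ← lintegral_add_compl _ (measurableSet_singleton z), lintegral_singleton]
  have h0 : (offDiag ν k z z : ℝ≥0∞) * ν {z} = 0 := by
    by_cases h : ν {z} = 0 <;> simp [offDiag, h]
  rw [h0, zero_add]
  refine setLIntegral_congr_fun (measurableSet_singleton z).compl fun y hy => ?_
  simp only [offDiag_of_ne ν k (Ne.symm hy)]

/-- If the Laplacian of `k` is bounded, then the degree of `k` off the diagonal is bounded. -/
theorem degree_offDiag_le [TopologicalSpace Z] [CompletelyRegularSpace Z] [BorelSpace Z]
    [MeasurableSingletonClass Z] (ν : Measure Z) [IsFiniteMeasure ν]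
    (hν : ∀ (z : Z) (δ : ℝ≥0∞), δ ≠ 0 → ∃ U, IsOpen U ∧ z ∈ U ∧ ν U < ν {z} + δ)
    {k : Z → Z → ℝ≥0} (hk : Measurable (Function.uncurry k))
    (hdeg : ∀ z, degree ν k z < ∞) {𝕜 : Type*} [RCLike 𝕜] (L : (Z →ᵇ 𝕜) →L[𝕜] (Z →ᵇ 𝕜))
    (hL : ∀ (ψ : Z →ᵇ 𝕜) (z : Z), L ψ z = laplacian ν k ψ z) (z : Z) :
    degree ν (offDiag ν k) z ≤ ENNReal.ofReal ‖L‖ := by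
  have hkz : Measurable (k z) := hk.comp measurable_prodMk_left
  rw [degree_offDiag]
  refine ENNReal.le_of_forall_pos_le_add fun ε hε _ => ?_
  -- Absolute continuity of the integral of `k z`: a punctured neighbourhood of `z` of measure below
  -- `δ` carries at most `ε`.
  obtain ⟨δ, hδ, hδk⟩ := exists_pos_setLIntegral_lt_of_measure_lt (hdeg z).ne
    (ENNReal.coe_ne_zero.2 hε.ne')
  obtain ⟨U, hU, hzU, hνU⟩ := hν z δ hδ.ne'
  have hdiff : ν (U \ {z}) < δ := by
    rw [measure_sdiff (singleton_subset_iff.2 hzU) (measurableSet_singleton z).nullMeasurableSet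
      (measure_ne_top _ _)]
    exact ENNReal.sub_lt_of_lt_add (measure_mono (singleton_subset_iff.2 hzU))
      (by rwa [add_comm] at hνU)
  -- Since `f` is 0 at `z` and 1 off `U`, `L ψ z` is the integral of `k z * f`, which dominates the
  -- mass of `k z` outside `U`.
  obtain ⟨f, hf, hfz, hf1⟩ := CompletelyRegularSpace.completely_regular z Uᶜ hU.isClosed_compl
    (fun h => h hzU)
  let ψ : Z →ᵇ 𝕜 := BoundedContinuousFunction.ofNormedAddCommGroup
    (fun y => ((f y : ℝ) : 𝕜)) (RCLike.continuous_ofReal.comp (continuous_subtype_val.comp hf)) 1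
    (fun y => by
      rw [RCLike.norm_ofReal, abs_of_nonneg (f y).2.1]
      exact (f y).2.2)
  have hψ : ‖ψ‖ ≤ 1 := BoundedContinuousFunction.norm_ofNormedAddCommGroup_le _ zero_le_one _
  have hLψ : L ψ z = ((∫ y, (k z y : ℝ) * (f y : ℝ) ∂ν : ℝ) : 𝕜) := by
    rw [hL, laplacian, ← integral_ofReal]
    refine integral_congr_ae (ae_of_all _ fun y => ?_)
    simp [ψ, hfz, RCLike.real_smul_eq_coe_mul]
  have hm : Measurable fun y => (k z y : ℝ) * (f y : ℝ) :=
    hkz.coe_nnreal_real.mul (continuous_subtype_val.comp hf).measurable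
  have hbound : ∫⁻ y in Uᶜ, (k z y : ℝ≥0∞) ∂ν ≤ ENNReal.ofReal ‖L‖ := by
    calc ∫⁻ y in Uᶜ, (k z y : ℝ≥0∞) ∂ν
        = ∫⁻ y in Uᶜ, ENNReal.ofReal ((k z y : ℝ) * (f y : ℝ)) ∂ν := by
          refine setLIntegral_congr_fun hU.measurableSet.compl fun y hy => ?_
          simp [hf1 hy]
      _ ≤ ∫⁻ y, ENNReal.ofReal ((k z y : ℝ) * (f y : ℝ)) ∂ν := setLIntegral_le_lintegral _ _
      _ = ENNReal.ofReal (∫ y, (k z y : ℝ) * (f y : ℝ) ∂ν) := by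
          refine (ofReal_integral_eq_lintegral_ofReal ?_ ?_).symm
          · refine ⟨hm.aestronglyMeasurable, ?_⟩
            refine lt_of_le_of_lt (lintegral_mono fun y => ?_) (hdeg z)
            rw [enorm_mul, ← ofReal_norm, Real.norm_of_nonneg (k z y).coe_nonneg, ENNReal.ofReal_coe_nnreal,
              ← ofReal_norm, Real.norm_of_nonneg (f y).2.1]
            exact mul_le_of_le_one_right' (ENNReal.ofReal_le_one.2 (f y).2.2)
          · exact ae_of_all _ fun y => mul_nonneg (k z y).coe_nonneg (f y).2.1
      _ ≤ ENNReal.ofReal ‖L‖ := by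
          refine ENNReal.ofReal_le_ofReal ?_
          calc ∫ y, (k z y : ℝ) * (f y : ℝ) ∂ν ≤ ‖L ψ z‖ := by
                rw [hLψ, RCLike.norm_ofReal]
                exact le_abs_self _
            _ ≤ ‖L ψ‖ := (L ψ).norm_coe_le_norm z
            _ ≤ ‖L‖ * ‖ψ‖ := L.le_opNorm ψ
            _ ≤ ‖L‖ := mul_le_of_le_one_right (norm_nonneg _) hψ
  calc ∫⁻ y in {z}ᶜ, (k z y : ℝ≥0∞) ∂ν
      ≤ ∫⁻ y in Uᶜ ∪ U \ {z}, (k z y : ℝ≥0∞) ∂ν := by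
        refine lintegral_mono_set fun y hy => ?_
        by_cases hyU : y ∈ U
        · exact Or.inr ⟨hyU, hy⟩
        · exact Or.inl hyU
    _ ≤ ∫⁻ y in Uᶜ, (k z y : ℝ≥0∞) ∂ν + ∫⁻ y in U \ {z}, (k z y : ℝ≥0∞) ∂ν :=
        lintegral_union_le _ _ _
    _ ≤ ENNReal.ofReal ‖L‖ + ε := add_le_add hbound (hδk _ hdiff).le

/-- The Markov kernel with density `g z` with respect to `ν` and the remaining mass at `z`. -/
noncomputable def lazyKernel (ν : Measure Z) [SFinite ν] (g : Z → Z → ℝ≥0)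
    (hg : Measurable (Function.uncurry g)) : Kernel Z Z where
  toFun z := ν.withDensity (fun y => (g z y : ℝ≥0∞)) + (1 - degree ν g z) • Measure.dirac z
  measurable' := by
    have hd : Measurable (degree ν g) := hg.coe_nnreal_ennreal.lintegral_prod_right'
    refine Measure.measurable_of_measurable_coe _ fun B hB => ?_
    simp only [Measure.add_apply, Measure.smul_apply, smul_eq_mul, withDensity_apply _ hB,
      Measure.dirac_apply' _ hB]
    refine Measurable.add ?_ ((measurable_const.sub hd).mul (measurable_one.indicator hB))
    exact hg.coe_nnreal_ennreal.lintegral_prod_right'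

variable {ν : Measure Z} [SFinite ν] {g : Z → Z → ℝ≥0} (hg : Measurable (Function.uncurry g))

theorem lazyKernel_apply (z : Z) : lazyKernel ν g hg z =
    ν.withDensity (fun y => (g z y : ℝ≥0∞)) + (1 - degree ν g z) • Measure.dirac z := rfl

theorem isMarkovKernel_lazyKernel (h1 : ∀ z, degree ν g z ≤ 1) :
    IsMarkovKernel (lazyKernel ν g hg) := by
  refine ⟨fun z => ⟨?_⟩⟩
  rw [lazyKernel_apply, Measure.add_apply, Measure.smul_apply, withDensity_apply _ MeasurableSet.univ,
    Measure.restrict_univ, measure_univ, smul_eq_mul, mul_one]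
  exact add_tsub_cancel_of_le (h1 z)

theorem integral_lazyKernel [TopologicalSpace Z] [BorelSpace Z] [IsFiniteMeasure ν]
    (h1 : ∀ z, degree ν g z ≤ 1)
    {𝕜 : Type*} [RCLike 𝕜] (ψ : Z →ᵇ 𝕜) (z : Z) :
    ∫ y, ψ y ∂(lazyKernel ν g hg z) = ψ z + laplacian ν g ψ z := by
  have := isMarkovKernel_lazyKernel hg h1
  have hgz : Measurable (g z) := hg.comp measurable_prodMk_left
  have hψ : Integrable ψ (lazyKernel ν g hg z) := ψ.integrable _
  rw [lazyKernel_apply] at hψ ⊢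
  have hψ1 := hψ.left_of_add_measure
  have hψm : StronglyMeasurable ψ := ψ.continuous.stronglyMeasurable
  have hgi : Integrable (fun y => (g z y : ℝ)) ν :=
    ⟨hgz.coe_nnreal_real.aestronglyMeasurable, by
      refine lt_of_eq_of_lt (lintegral_congr fun y => ?_) ((h1 z).trans_lt ENNReal.one_lt_top)
      simp only
      rw [← ofReal_norm, Real.norm_of_nonneg (g z y).coe_nonneg, ENNReal.ofReal_coe_nnreal]⟩
  have hgψ : Integrable (fun y => (g z y : ℝ) • ψ y) ν :=
    (integrable_withDensity_iff_integrable_smul hgz).1 hψ1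
  have hd : (degree ν g z).toReal = ∫ y, (g z y : ℝ) ∂ν := by
    rw [integral_eq_lintegral_of_nonneg_ae (ae_of_all _ fun y => (g z y).coe_nonneg)
      hgz.coe_nnreal_real.aestronglyMeasurable]
    simp only [ENNReal.ofReal_coe_nnreal, degree]
  rw [integral_add_measure hψ1 hψ.right_of_add_measure, integral_smul_measure,
    integral_dirac' _ _ hψm, integral_withDensity_eq_integral_smul hgz, laplacian,
    ENNReal.toReal_sub_of_le (h1 z) ENNReal.one_ne_top, hd]
  simp only [smul_sub]
  rw [integral_sub hgψ (hgi.smul_const _), integral_smul_const, sub_smul, ENNReal.toReal_one,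
    one_smul]
  simp only [NNReal.smul_def]
  abel

end JumpKernel

end HeatMarkov

namespace HeatMarkov

/-! ### The semigroup as integration against the transition kernels -/

section Main

variable {Z : Type*} [MeasurableSpace Z] [TopologicalSpace Z] [BorelSpace Z]
  {𝕜 : Type*} [RCLike 𝕜]

theorem integral_kernelPow (κ : Kernel Z Z) [IsMarkovKernel κ]
    (A : (Z →ᵇ 𝕜) →L[ℝ] (Z →ᵇ 𝕜)) (hA : ∀ ψ z, A ψ z = ∫ y, ψ y ∂(κ z)) (ψ : Z →ᵇ 𝕜) (n : ℕ) :
    ∀ z, ∫ y, ψ y ∂(kernelPow κ n z) = (A ^ n) ψ z := by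
  induction n with
  | zero =>
    intro z
    rw [kernelPow, Kernel.id_apply, integral_dirac' _ _ ψ.continuous.stronglyMeasurable]
    rfl
  | succ n ih =>
    intro z
    rw [pow_succ', mul_apply_eq_comp, hA, kernelPow,
      Kernel.integral_comp (ψ.integrable _)]
    exact integral_congr_ae (ae_of_all _ ih)

theorem exp_apply_eq_integral_jumpTransition (κ : Kernel Z Z) [IsMarkovKernel κ]
    (A : (Z →ᵇ 𝕜) →L[ℝ] (Z →ᵇ 𝕜)) (hA : ∀ ψ z, A ψ z = ∫ y, ψ y ∂(κ z)) (c t : ℝ≥0)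
    (ψ : Z →ᵇ 𝕜) (z : Z) :
    NormedSpace.exp ((t : ℝ) • ((c : ℝ) • (A - 1))) ψ z =
      ∫ y, ψ y ∂(jumpTransition κ c t z) := by
  have h1 := (hasSum_exp_smul_sub_one A (c * t) ψ).mapL
    (BoundedContinuousFunction.evalCLM ℝ z)
  have hi : Integrable ψ (jumpTransition κ c t z) := ψ.integrable _
  rw [jumpTransition_apply_eq_sum] at hi ⊢
  have h2 := hasSum_integral_measure hi
  rw [smul_smul, mul_comm, ← NNReal.coe_mul]
  have h3 (n : ℕ) : BoundedContinuousFunction.evalCLM ℝ z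
      ((poissonMeasure (c * t)).real {n} • (A ^ n) ψ) =
        ∫ y, ψ y ∂(poissonMeasure (c * t) {n} • kernelPow κ n z) := by
    rw [integral_smul_measure, integral_kernelPow κ A hA]
    rfl
  exact h1.unique ((funext h3 : _ = _) ▸ h2)

end Main

/-! ### The measure on the complement of a null set -/

section Subspace

variable {X : Type*} [MeasurableSpace X] {μ : Measure X} {N : Set X}

/-- `N` need not be Borel; being null, it has a null measurable complement, which is enough for the
images of measurable sets. -/
theorem comap_val_compl_apply (hN : μ N = 0) {s : Set (Nᶜ : Set X)} (hs : MeasurableSet s) :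
    μ.comap (Subtype.val : (Nᶜ : Set X) → X) s = μ (Subtype.val '' s) := by
  refine Measure.comap_apply₀ _ _ Subtype.val_injective ?_ hs.nullMeasurableSet
  rintro _ ⟨t, ht, rfl⟩
  rw [Subtype.image_preimage_coe]
  exact (NullMeasurableSet.of_null hN).compl.inter ht.nullMeasurableSet

theorem isFiniteMeasure_comap_val_compl [IsFiniteMeasure μ] (hN : μ N = 0) :
    IsFiniteMeasure (μ.comap (Subtype.val : (Nᶜ : Set X) → X)) :=
  ⟨by
    rw [comap_val_compl_apply hN MeasurableSet.univ]
    exact measure_lt_top _ _⟩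

theorem exists_isOpen_comap_val_compl_lt [TopologicalSpace X] [T1Space X] [BorelSpace X]
    [IsFiniteMeasure μ] [μ.OuterRegular] (hN : μ N = 0) (z : (Nᶜ : Set X)) {δ : ℝ≥0∞}
    (hδ : δ ≠ 0) : ∃ U : Set (Nᶜ : Set X), IsOpen U ∧ z ∈ U ∧
      μ.comap Subtype.val U < μ.comap Subtype.val {z} + δ := by
  obtain ⟨U, hzU, hU, hlt⟩ := Set.exists_isOpen_lt_of_lt {(z : X)} (μ {(z : X)} + δ)
    (ENNReal.lt_add_right (measure_ne_top _ _) hδ)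
  have hU' : IsOpen ((Subtype.val : (Nᶜ : Set X) → X) ⁻¹' U) := hU.preimage continuous_subtype_val
  refine ⟨_, hU', hzU rfl, ?_⟩
  rw [comap_val_compl_apply hN hU'.measurableSet,
    comap_val_compl_apply hN (measurableSet_singleton z), image_singleton]
  exact (measure_mono (image_preimage_subset _ _)).trans_lt hlt

end Subspace

end HeatMarkov

/-! ### Assembly -/

theorem mainTheorem4 {𝕜 : Type*} [RCLike 𝕜]
    {X : Type u} [TopologicalSpace X] [CompactSpace X] [T2Space X]
    [MeasurableSpace X] [BorelSpace X]
    (μ : Measure X) [μ.Regular]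
    (N : Set X) (hN : μ N = 0)
    -- `Z = X \ N` with the subspace topology, and the restriction `ν` of `μ` to `Z`
    (ν : Measure (Nᶜ : Set X)) (hν : ν = μ.comap Subtype.val)
    -- the kernel
    (k : (Nᶜ : Set X) → (Nᶜ : Set X) → ℝ≥0) (hk : Measurable (Function.uncurry k))
    (hk_int : ∫⁻ x, ∫⁻ y, (k x y : ℝ≥0∞) ∂ν ∂ν < ∞)
    (hdeg_fin : ∀ z, HeatMarkov.degree ν k z < ∞)
    (hdeg_pos : ∀ z, 0 < HeatMarkov.degree ν k z)
    -- the Laplacian is a bounded operator on `C(Z)` with the supremum norm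
    (L : ((Nᶜ : Set X) →ᵇ 𝕜) →L[𝕜] ((Nᶜ : Set X) →ᵇ 𝕜))
    (hL : ∀ (ψ : (Nᶜ : Set X) →ᵇ 𝕜) (z : (Nᶜ : Set X)),
      L ψ z = HeatMarkov.laplacian ν k ψ z) :
    ∃ p : ℝ≥0 → Kernel (Nᶜ : Set X) (Nᶜ : Set X),
      HeatMarkov.IsTransitionFunction p ∧
      (∀ h₀ : (Nᶜ : Set X) →ᵇ 𝕜, ∃ h : ℝ → ((Nᶜ : Set X) →ᵇ 𝕜),
        HeatMarkov.IsCauchySolution L h₀ h ∧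
        (∀ (t : ℝ≥0) (z : (Nᶜ : Set X)), h t z = ∫ y, h₀ y ∂(p t z)) ∧
        ∀ h' : ℝ → ((Nᶜ : Set X) →ᵇ 𝕜), HeatMarkov.IsCauchySolution L h₀ h' →
          EqOn h' h (Ici 0)) ∧
      ∃ (Ω : Type u) (_ : MeasurableSpace Ω) (P : Kernel (Nᶜ : Set X) Ω)
        (Y : ℝ≥0 → Ω → (Nᶜ : Set X)),
        HeatMarkov.IsStrongMarkovProcess p P Y ∧
        ∀ ω, HeatMarkov.IsCadlagPath fun t => Y t ω := by
  subst hν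
  have := HeatMarkov.isFiniteMeasure_comap_val_compl (μ := μ) hN
  set ν : Measure (Nᶜ : Set X) := μ.comap Subtype.val
  -- Any positive bound for the off-diagonal degree would do as a rate; adding 1 keeps `c` nonzero
  -- when `L = 0`.
  let c : ℝ≥0 := ‖L‖₊ + 1
  have hc : (c : ℝ) ≠ 0 := by positivity
  have hc' : c ≠ 0 := by exact_mod_cast hc
  let g : (Nᶜ : Set X) → (Nᶜ : Set X) → ℝ≥0 := fun z y => c⁻¹ * HeatMarkov.offDiag ν k z y
  have hg : Measurable (Function.uncurry g) := (HeatMarkov.measurable_offDiag ν hk).const_mul _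
  have hg1 : ∀ z, HeatMarkov.degree ν g z ≤ 1 := by
    intro z
    have hle := HeatMarkov.degree_offDiag_le ν
      (fun z δ hδ => HeatMarkov.exists_isOpen_comap_val_compl_lt hN z hδ) hk hdeg_fin L hL z
    have hle' : HeatMarkov.degree ν (HeatMarkov.offDiag ν k) z ≤ c := by
      refine hle.trans ?_
      rw [ofReal_norm, enorm_eq_nnnorm]
      exact ENNReal.coe_le_coe.2 le_self_add
    have : HeatMarkov.degree ν g z =
        (c : ℝ≥0∞)⁻¹ * HeatMarkov.degree ν (HeatMarkov.offDiag ν k) z := by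
      rw [HeatMarkov.degree, HeatMarkov.degree, ← lintegral_const_mul' _ _ (by simpa using hc')]
      simp only [g, ENNReal.coe_mul, ENNReal.coe_inv hc']
    rw [this, mul_comm, ← div_eq_mul_inv]
    exact ENNReal.div_le_of_le_mul (by rwa [one_mul])
  let κ := HeatMarkov.lazyKernel ν g hg
  have hκ : IsMarkovKernel κ := HeatMarkov.isMarkovKernel_lazyKernel hg hg1
  let L' : ((Nᶜ : Set X) →ᵇ 𝕜) →L[ℝ] ((Nᶜ : Set X) →ᵇ 𝕜) := L.restrictScalars ℝ
  let A : ((Nᶜ : Set X) →ᵇ 𝕜) →L[ℝ] ((Nᶜ : Set X) →ᵇ 𝕜) := 1 + (c : ℝ)⁻¹ • L'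
  have hA : ∀ ψ z, A ψ z = ∫ y, ψ y ∂(κ z) := by
    intro ψ z
    rw [HeatMarkov.integral_lazyKernel hg hg1]
    have h1 : A ψ z = ψ z + (c : ℝ)⁻¹ • L ψ z := rfl
    rw [h1, hL, HeatMarkov.laplacian, HeatMarkov.laplacian, ← integral_smul]
    congr 2
    ext y
    -- On the diagonal `ψ y - ψ z` vanishes, so `k` and `offDiag ν k` have the same Laplacian.
    by_cases hzy : z = y
    · simp [hzy]
    · simp only [g, HeatMarkov.offDiag_of_ne ν k hzy, smul_smul, NNReal.coe_mul, NNReal.coe_inv]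
  have hLA : L' = (c : ℝ) • (A - 1) := by
    simp only [A, add_sub_cancel_left, smul_inv_smul₀ hc]
  refine ⟨HeatMarkov.jumpTransition κ c, HeatMarkov.isTransitionFunction_jumpTransition κ c,
    fun h₀ => ⟨fun t => NormedSpace.exp (t • L') h₀, HeatMarkov.isCauchySolution_exp L' h₀,
      fun t z => ?_, fun h' hh' t ht => ?_⟩, (ℕ → (Nᶜ : Set X)) × HeatMarkov.nonexplosive,
    inferInstance, HeatMarkov.jumpLaw κ, HeatMarkov.jumpProcess c,
    HeatMarkov.isStrongMarkovProcess_jumpProcess κ c, HeatMarkov.isCadlagPath_jumpProcess c⟩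
  · rw [hLA]
    exact HeatMarkov.exp_apply_eq_integral_jumpTransition κ A hA c t h₀ z
  · exact HeatMarkov.IsCauchySolution.eq_exp (L := L') hh' ht
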